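/- Let $\mathcal H\rightrightarrows N$ and $\mathcal G\rightrightarrows M$ be (finite-dimensional) Lie groupoids, with source, target, unit and inversion maps $s,t,u,i$; the bases $N,M$ are Hausdorff, while $\mathcal H,\mathcal G$ need not be Hausdorff. Let $A_{\mathcal G}=\ker(ds)|_{u(M)}$ be the Lie algebroid of $\mathcal G$. Let $(\Phi_0,\phi_0):\mathcal H\to\mathcal G$ be a Lie groupoid morphism and let $(\Phi_\varepsilon,\phi_\varepsilon)_{\varepsilon\in I}$ be a deformation of it, i.e. $I\subseteq\mathbb R$ is an open interval containing $0$, the maps $(h,\varepsilon)\mapsto\Phi_\varepsilon(h)\in\mathcal G$ and $(x,\varepsilon)\mapsto\phi_\varepsilon(x)\in M$ are smooth on $\mathcal H\times I$ and $N\times I$, each $(\Phi_\varepsilon,\phi_\varepsilon)$ is a Lie groupoid morphism, and at $\varepsilon=0$ it is $(\Phi_0,\phi_0)$. For an open interval $J\subseteq I$ containing $0$, say that * the deformation is *trivial over $J$* if there is a smooth map $\tau:N\times J\to\mathcal G$, $\tau_\varepsilon=\tau(\cdot,\varepsilon)$, with $s\circ\tau_\varepsilon=\phi_0$ and $\tau_0=u\circ\phi_0$,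 such that $\Phi_\varepsilon=\tau_\varepsilon\cdot\Phi_0$, that is, $\Phi_\varepsilon(h)=\tau_\varepsilon(t(h))\,\Phi_0(h)\,\tau_\varepsilon(s(h))^{-1}$, for all $\varepsilon\in J$ and $h\in\mathcal H$; * the family of deformation cocycles $X_\varepsilon(h)=\frac{d}{d\varepsilon}\Phi_\varepsilon(h)\in T_{\Phi_\varepsilon(h)}\mathcal G$ is *smoothly exact over $J$* if there are sections $\alpha_\varepsilon$ of $\phi_\varepsilon^*A_{\mathcal G}$ ($\varepsilon\in J$), smooth in $(x,\varepsilon)\in N\times J$, such that $X_\varepsilon=\delta_{\Phi_\varepsilon}(\alpha_\varepsilon)$ for all $\varepsilon\in J$, where $$\delta_{\Phi}(\alpha)(h)=r_{\Phi(h)}\big(\alpha_{t(h)}\big)+l_{\Phi(h)}\big(di(\alpha_{s(h)})\big)$$ and $r_g$, $l_g$ are the differentials of right and left translation by $g$. **Theorem.** For every open interval $J\subseteq I$ containing $0$ (in particular for $J=I$), the deformation is trivial over $J$ if and only if the family $X_\varepsilon$ is smoothly exact over $J$. Consequently, the deformation is trivial (trivial over some open interval $J\subseteq I$ containing $0$)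 if and only if the family $X_\varepsilon$ is smoothly exact (over some open interval $J\subseteq I$ containing $0$). -/

import Mathlib

open scoped Manifold ContDiff

/-- A Lie groupoid `G ⇉ M`, where `G` and `M` are smooth manifolds modelled on the vector spaces
`EG` and `EM`. The multiplication is a function on all of `G × G`, but only its values on the
composable pairs `(g, h)`, i.e. those with `source g = target h`, carry meaning: all axioms concern
these pairs only. Smoothness of the multiplication is smoothness on the submanifold
of composable pairs of `G × G`. -/
structure LieGroupoid (EG EM G M : Type*)
    [NormedAddCommGroup EG] [NormedSpace ℝ EG] [NormedAddCommGroup EM] [NormedSpace ℝ EM]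
    [TopologicalSpace G] [ChartedSpace EG G] [TopologicalSpace M] [ChartedSpace EM M] where
  source : G → M
  target : G → M
  unit : M → G
  inv : G → G
  mul : G → G → G
  source_unit : ∀ x, source (unit x) = x
  target_unit : ∀ x, target (unit x) = x
  source_mul : ∀ g h, source g = target h → source (mul g h) = source h
  target_mul : ∀ g h, source g = target h → target (mul g h) = target g
  mul_assoc : ∀ g h k, source g = target h → source h = target k →
    mul (mul g h) k = mul g (mul h k)
  unit_mul : ∀ g, mul (unit (target g)) g = g
  mul_unit : ∀ g, mul g (unit (source g)) = g
  source_inv : ∀ g, source (inv g) = target g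
  target_inv : ∀ g, target (inv g) = source g
  inv_mul : ∀ g, mul (inv g) g = unit (source g)
  mul_inv : ∀ g, mul g (inv g) = unit (target g)
  isSubmersion_source : Manifold.IsSubmersion 𝓘(ℝ, EG) 𝓘(ℝ, EM) ∞ source
  isSubmersion_target : Manifold.IsSubmersion 𝓘(ℝ, EG) 𝓘(ℝ, EM) ∞ target
  contMDiff_unit : ContMDiff 𝓘(ℝ, EM) 𝓘(ℝ, EG) ∞ unit
  contMDiff_inv : ContMDiff 𝓘(ℝ, EG) 𝓘(ℝ, EG) ∞ inv
  contMDiffOn_mul : ContMDiffOn (𝓘(ℝ, EG).prod 𝓘(ℝ, EG)) 𝓘(ℝ, EG) ∞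
    (fun p : G × G => mul p.1 p.2) {p : G × G | source p.1 = target p.2}

namespace LieGroupoid

variable {EG EM G M : Type*}
  [NormedAddCommGroup EG] [NormedSpace ℝ EG] [NormedAddCommGroup EM] [NormedSpace ℝ EM]
  [TopologicalSpace G] [ChartedSpace EG G] [TopologicalSpace M] [ChartedSpace EM M]

/-- The fibre over `x` of the Lie algebroid `A_G`: the kernel of `ds` in the tangent space of `G`
at the unit of `x`. -/
noncomputable def algebroidFiber (𝓖 : LieGroupoid EG EM G M) (x : M) :
    Submodule ℝ (TangentSpace 𝓘(ℝ, EG) (𝓖.unit x)) :=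
  LinearMap.ker (mfderiv 𝓘(ℝ, EG) 𝓘(ℝ, EM) 𝓖.source (𝓖.unit x)).toLinearMap

/-- For an arrow `g` with target `x`, the differential `r_g` at the unit of `x` of the right
translation `R_g : s⁻¹(x) → G`, `R_g k = k g`. It is meaningful on vectors tangent to `s⁻¹(x)` at
the unit, i.e. on `algebroidFiber x`. It takes values in the tangent space at `(unit x) g = g`. -/
noncomputable def rightTranslation (𝓖 : LieGroupoid EG EM G M) (x : M) (g : G)
    (v : TangentSpace 𝓘(ℝ, EG) (𝓖.unit x)) : TangentSpace 𝓘(ℝ, EG) g :=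
  mfderivWithin 𝓘(ℝ, EG) 𝓘(ℝ, EG) (fun k => 𝓖.mul k g) {k | 𝓖.source k = x} (𝓖.unit x) v

/-- For an arrow `g` with source `x`, the differential `l_g` at the unit of `x` of the left
translation `L_g : t⁻¹(x) → G`, `L_g k = g k`. It is meaningful on vectors tangent to `t⁻¹(x)` at
the unit. It takes values in the tangent space at `g (unit x) = g`. -/
noncomputable def leftTranslation (𝓖 : LieGroupoid EG EM G M) (x : M) (g : G)
    (v : TangentSpace 𝓘(ℝ, EG) (𝓖.unit x)) : TangentSpace 𝓘(ℝ, EG) g :=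
  mfderivWithin 𝓘(ℝ, EG) 𝓘(ℝ, EG) (fun k => 𝓖.mul g k) {k | 𝓖.target k = x} (𝓖.unit x) v

/-- The differential `di` of the inversion at the unit of `x`, an endomorphism of the tangent space
there because `i (unit x) = unit x`. -/
noncomputable def invDifferential (𝓖 : LieGroupoid EG EM G M) (x : M)
    (v : TangentSpace 𝓘(ℝ, EG) (𝓖.unit x)) : TangentSpace 𝓘(ℝ, EG) (𝓖.unit x) :=
  mfderiv 𝓘(ℝ, EG) 𝓘(ℝ, EG) 𝓖.inv (𝓖.unit x) v

end LieGroupoid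

section Morphisms

variable {EH EN H N EG EM G M : Type*}
  [NormedAddCommGroup EH] [NormedSpace ℝ EH] [NormedAddCommGroup EN] [NormedSpace ℝ EN]
  [NormedAddCommGroup EG] [NormedSpace ℝ EG] [NormedAddCommGroup EM] [NormedSpace ℝ EM]
  [TopologicalSpace H] [ChartedSpace EH H] [TopologicalSpace N] [ChartedSpace EN N]
  [TopologicalSpace G] [ChartedSpace EG G] [TopologicalSpace M] [ChartedSpace EM M]

/-- `(Φ, φ)` is a morphism of Lie groupoids from `H ⇉ N` to `G ⇉ M`: a smooth functor. -/
structure IsLieGroupoidHom (𝓗 : LieGroupoid EH EN H N) (𝓖 : LieGroupoid EG EM G M)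
    (Φ : H → G) (φ : N → M) : Prop where
  contMDiff : ContMDiff 𝓘(ℝ, EH) 𝓘(ℝ, EG) ∞ Φ
  contMDiff_base : ContMDiff 𝓘(ℝ, EN) 𝓘(ℝ, EM) ∞ φ
  source_map : ∀ h, 𝓖.source (Φ h) = φ (𝓗.source h)
  target_map : ∀ h, 𝓖.target (Φ h) = φ (𝓗.target h)
  map_unit : ∀ x, Φ (𝓗.unit x) = 𝓖.unit (φ x)
  map_mul : ∀ h k, 𝓗.source h = 𝓗.target k → Φ (𝓗.mul h k) = 𝓖.mul (Φ h) (Φ k)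

/-- A morphism of Lie groupoids, bundled: the map of arrows and the base map. -/
structure LieGroupoidHom (𝓗 : LieGroupoid EH EN H N) (𝓖 : LieGroupoid EG EM G M) where
  toFun : H → G
  base : N → M
  isHom : IsLieGroupoidHom 𝓗 𝓖 toFun base

/-- The differential `δ_Φ : C⁰_def(Φ) → C¹_def(Φ)` of a section `α` of `φ^* A_G`:
`(δ_Φ α)(h) = r_{Φ(h)}(α_{t(h)}) + l_{Φ(h)}(di(α_{s(h)}))`. -/
noncomputable def deformationDifferential (𝓗 : LieGroupoid EH EN H N)
    (𝓖 : LieGroupoid EG EM G M) (Φ : H → G) (φ : N → M)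
    (α : ∀ x : N, TangentSpace 𝓘(ℝ, EG) (𝓖.unit (φ x))) (h : H) :
    TangentSpace 𝓘(ℝ, EG) (Φ h) :=
  𝓖.rightTranslation (φ (𝓗.target h)) (Φ h) (α (𝓗.target h)) +
    𝓖.leftTranslation (φ (𝓗.source h)) (Φ h)
      (𝓖.invDifferential (φ (𝓗.source h)) (α (𝓗.source h)))

/-- `J` is an open interval of the real line (bounded or not) that contains `0`. -/
def IsOpenIntervalAroundZero (J : Set ℝ) : Prop :=
  IsOpen J ∧ J.OrdConnected ∧ (0 : ℝ) ∈ J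

/-- A deformation, over the interval `I`, of a morphism `Φ₀` of Lie groupoids. Only the values of
`toFun` and `base` at parameters in `I` carry meaning. -/
structure MorphismDeformation (𝓗 : LieGroupoid EH EN H N) (𝓖 : LieGroupoid EG EM G M)
    (Φ₀ : LieGroupoidHom 𝓗 𝓖) (I : Set ℝ) where
  toFun : H × ℝ → G
  base : N × ℝ → M
  contMDiffOn : ContMDiffOn (𝓘(ℝ, EH).prod 𝓘(ℝ, ℝ)) 𝓘(ℝ, EG) ∞ toFun (Set.univ ×ˢ I)
  contMDiffOn_base : ContMDiffOn (𝓘(ℝ, EN).prod 𝓘(ℝ, ℝ)) 𝓘(ℝ, EM) ∞ base (Set.univ ×ˢ I)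
  toFun_zero : ∀ h, toFun (h, 0) = Φ₀.toFun h
  base_zero : ∀ x, base (x, 0) = Φ₀.base x
  isHom : ∀ ε ∈ I, IsLieGroupoidHom 𝓗 𝓖 (fun h => toFun (h, ε)) (fun x => base (x, ε))

namespace MorphismDeformation

variable {𝓗 : LieGroupoid EH EN H N} {𝓖 : LieGroupoid EG EM G M}
  {Φ₀ : LieGroupoidHom 𝓗 𝓖} {I : Set ℝ}

/-- The constant deformation of `Φ₀`. -/
def const (Φ₀ : LieGroupoidHom 𝓗 𝓖) (I : Set ℝ) : MorphismDeformation 𝓗 𝓖 Φ₀ I where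
  toFun p := Φ₀.toFun p.1
  base p := Φ₀.base p.1
  contMDiffOn := (Φ₀.isHom.contMDiff.comp contMDiff_fst).contMDiffOn
  contMDiffOn_base := (Φ₀.isHom.contMDiff_base.comp contMDiff_fst).contMDiffOn
  toFun_zero _ := rfl
  base_zero _ := rfl
  isHom _ _ := Φ₀.isHom

/-- `τ` is a family of gauge maps `τ_ε : N → G`, smooth in `(x, ε)` for `ε ∈ J`, where `τ_ε` covers
the map `f_ε : N → M`, that is, `s ∘ τ_ε = f_ε`. -/
structure IsSmoothGaugeFamily (𝓖 : LieGroupoid EG EM G M) (f : N × ℝ → M) (J : Set ℝ)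
    (τ : N × ℝ → G) : Prop where
  contMDiffOn : ContMDiffOn (𝓘(ℝ, EN).prod 𝓘(ℝ, ℝ)) 𝓘(ℝ, EG) ∞ τ (Set.univ ×ˢ J)
  source_eq : ∀ x, ∀ ε ∈ J, 𝓖.source (τ (x, ε)) = f (x, ε)

/-- The deformations `Φ` and `Φ'` of `Φ₀` are equivalent over `J`: there is a smooth family of gauge
maps `τ_ε`, `ε ∈ J`, covering the base maps of `Φ_ε`, with `τ_0 = u ∘ φ₀`, such that
`Φ'_ε(h) = τ_ε(t(h)) Φ_ε(h) τ_ε(s(h))⁻¹` for all `h` and all `ε ∈ J`. -/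
def EquivalentOn (Φ Φ' : MorphismDeformation 𝓗 𝓖 Φ₀ I) (J : Set ℝ) : Prop :=
  ∃ τ : N × ℝ → G, IsSmoothGaugeFamily (EN := EN) 𝓖 Φ.base J τ ∧
    (∀ x, τ (x, 0) = 𝓖.unit (Φ₀.base x)) ∧
    ∀ ε ∈ J, ∀ h, Φ'.toFun (h, ε) =
      𝓖.mul (𝓖.mul (τ (𝓗.target h, ε)) (Φ.toFun (h, ε))) (𝓖.inv (τ (𝓗.source h, ε)))

/-- `Φ` is trivial over `J`: over `J` it is equivalent to the constant deformation, i.e.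
`Φ_ε = τ_ε · Φ₀` for `ε ∈ J`. -/
def IsTrivialOn (Φ : MorphismDeformation 𝓗 𝓖 Φ₀ I) (J : Set ℝ) : Prop :=
  (const Φ₀ I).EquivalentOn Φ J

/-- `Φ` is trivial: it is trivial over some open interval containing `0`. -/
def IsTrivial (Φ : MorphismDeformation 𝓗 𝓖 Φ₀ I) : Prop :=
  ∃ J : Set ℝ, IsOpenIntervalAroundZero J ∧ J ⊆ I ∧ Φ.IsTrivialOn J

/-- The deformation cocycle `X_ε(h) = d/dε Φ_ε(h)`, a tangent vector of `G` at `Φ_ε(h)`. -/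
noncomputable def cocycle (Φ : MorphismDeformation 𝓗 𝓖 Φ₀ I) (ε : ℝ) (h : H) :
    TangentSpace 𝓘(ℝ, EG) (Φ.toFun (h, ε)) :=
  mfderiv 𝓘(ℝ, ℝ) 𝓘(ℝ, EG) (fun e : ℝ => Φ.toFun (h, e)) ε (1 : ℝ)

variable [IsManifold 𝓘(ℝ, EG) ∞ G]

/-- `α` is a family, smooth in `(x, ε)` for `ε ∈ J`, of sections `α_ε` of the pull-backs
`f_ε^* A_G`. As `A_G` is a subbundle of the restriction of `TG` to the embedded submanifold of
units, smoothness of the section is smoothness as a map into `TG`. -/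
structure IsSmoothSectionFamily (𝓖 : LieGroupoid EG EM G M) (f : N × ℝ → M) (J : Set ℝ)
    (α : ∀ p : N × ℝ, TangentSpace 𝓘(ℝ, EG) (𝓖.unit (f p))) : Prop where
  mem : ∀ x, ∀ ε ∈ J, α (x, ε) ∈ 𝓖.algebroidFiber (f (x, ε))
  contMDiffOn : ContMDiffOn (𝓘(ℝ, EN).prod 𝓘(ℝ, ℝ)) 𝓘(ℝ, EG).tangent ∞
    (fun p : N × ℝ => (⟨𝓖.unit (f p), α p⟩ : TangentBundle 𝓘(ℝ, EG) G)) (Set.univ ×ˢ J)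

/-- The family of deformation cocycles `X_ε` of `Φ` is smoothly exact over `J`: there is a smooth
family of sections `α_ε` of `φ_ε^* A_G`, `ε ∈ J`, with `X_ε = δ_{Φ_ε}(α_ε)` for all `ε ∈ J`. -/
def IsSmoothlyExactOn (Φ : MorphismDeformation 𝓗 𝓖 Φ₀ I) (J : Set ℝ) : Prop :=
  ∃ α : ∀ p : N × ℝ, TangentSpace 𝓘(ℝ, EG) (𝓖.unit (Φ.base p)),
    IsSmoothSectionFamily (EN := EN) 𝓖 Φ.base J α ∧
    ∀ ε ∈ J, ∀ h, Φ.cocycle ε h =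
      deformationDifferential 𝓗 𝓖 (fun k => Φ.toFun (k, ε)) (fun x => Φ.base (x, ε))
        (fun x => α (x, ε)) h

/-- The family of deformation cocycles of `Φ` is smoothly exact, over some open interval
containing `0`. -/
def IsSmoothlyExact (Φ : MorphismDeformation 𝓗 𝓖 Φ₀ I) : Prop :=
  ∃ J : Set ℝ, IsOpenIntervalAroundZero J ∧ J ⊆ I ∧ Φ.IsSmoothlyExactOn J

end MorphismDeformation

end Morphisms

/-! Both directions compare `τ` with its right logarithmic derivative, the velocity at `t = ε` of `t
↦ τ_t(x) τ_ε(x)⁻¹`, a curve in a source fibre through a unit. From trivial to exact: let `α_ε(x)` be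
this velocity. Then `Φ_t(h) = a(t) Φ_ε(h) b(t)⁻¹` with `a`, `b` the curves above over `t(h)` and
`s(h)`. The product rule `hasVelocity_mul_mul_inv` gives `X_ε = δ(α_ε)`. From exact to trivial: `τ`
is obtained by integrating `τ' = r_τ(α)`, `τ_0 = u ∘ φ₀`. Exactness on unit arrows says that the
anchor of `α_ε` is the velocity of `φ_ε` (`exists_hasVelocity_anchor`), so the solution has target
`φ_ε(x)`. This prevents blow-up: near every time `t₀ ∈ J` there is a solution starting at the unit
of `φ_{t₀}(x)` (`exists_isLogSolution`), and its right translates continue every solution that gets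
close to `t₀`. Hence solutions exist on all of `J` (`exists_of_forall_local`) and glue in `x` by
uniqueness (`exists_global`). Finally `τ_ε(t(h))⁻¹ Φ_ε(h) τ_ε(s(h))` has zero velocity, so it keeps
its initial value `Φ₀(h)` (`eq_of_hasLogVelocity`). Since `G` need not be Hausdorff, uniqueness
never uses closedness of an equalizer: a curve with zero velocity is locally constant, hence
constant on an interval, and uniqueness of `τ` follows by applying this to `τ⁻¹σ`. The analytic
input, smooth dependence of solutions on time and parameters, comes from the inverse function
theorem applied to an integral equation in `C([-1, 1], X)`. -/

/-! ### Smoothness of postcomposition on spaces of continuous functions. -/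

section Nemytskii

open Set Filter Topology

universe u
variable {K : Type*} [TopologicalSpace K] [CompactSpace K]
  {E F : Type u} [NormedAddCommGroup E] [NormedSpace ℝ E] [NormedAddCommGroup F] [NormedSpace ℝ F]

/-- Pointwise application of a continuous family of operators to a continuous family of vectors,
as a bounded bilinear map. -/
noncomputable def ContinuousMap.pointwiseApplyL (K : Type*) [TopologicalSpace K] [CompactSpace K]
    (E F : Type*) [NormedAddCommGroup E] [NormedSpace ℝ E] [NormedAddCommGroup F]
    [NormedSpace ℝ F] : C(K, E →L[ℝ] F) →L[ℝ] C(K, E) →L[ℝ] C(K, F) :=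
  LinearMap.mkContinuous₂
    (LinearMap.mk₂ ℝ (fun (A : C(K, E →L[ℝ] F)) (h : C(K, E)) =>
      (⟨fun t => A t (h t), by fun_prop⟩ : C(K, F)))
      (fun A A' h => by ext t; simp) (fun c A h => by ext t; simp)
      (fun A h h' => by ext t; simp) (fun c A h => by ext t; simp)) 1
    (fun A h => by
      rw [ContinuousMap.norm_le _ (by positivity)]
      intro t
      rw [one_mul]
      exact ((A t).le_opNorm (h t)).trans
        (mul_le_mul (A.norm_coe_le_norm t) (h.norm_coe_le_norm t) (norm_nonneg _)
          (norm_nonneg A)))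

/-- The mean value inequality is applied at each `t`. It is uniform in `t` because `v ↦ f' ∘ v` is
continuous for the sup norm. -/
theorem ContinuousMap.hasFDerivAt_postcomp (f : C(E, F)) (f' : C(E, E →L[ℝ] F))
    (hf : ∀ x, HasFDerivAt f (f' x) x) (u : C(K, E)) :
    HasFDerivAt (fun v : C(K, E) => f.comp v)
      (ContinuousMap.pointwiseApplyL K E F (f'.comp u)) u := by
  rw [hasFDerivAt_iff_isLittleO, Asymptotics.isLittleO_iff]
  intro c hc
  have hcont : ContinuousAt (fun v : C(K, E) => f'.comp v) u :=
    (ContinuousMap.continuous_postcomp f').continuousAt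
  obtain ⟨δ, hδ, hball⟩ := (Metric.continuousAt_iff (f := fun v : C(K, E) => f'.comp v)).1
    hcont c hc
  filter_upwards [Metric.ball_mem_nhds u hδ] with v hv
  rw [ContinuousMap.norm_le _ (by positivity)]
  intro t
  have hut : ∀ y ∈ Metric.ball (u t) δ, ‖f' y - f' (u t)‖ ≤ c := by
    intro y hy
    -- Shifting `u` by the constant `y - u t` gives a function in the `δ`-ball with value `y` at
    -- `t`, so continuity at the function `u` bounds `f' y - f' (u t)`.
    have h1 : dist (u + ContinuousMap.const K (y - u t)) u < δ := by
      rw [dist_eq_norm, add_sub_cancel_left]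
      refine lt_of_le_of_lt ((ContinuousMap.norm_le _ (norm_nonneg (y - u t))).2 fun s => ?_)
        (by rwa [Metric.mem_ball, dist_eq_norm] at hy)
      simp
    have h2 := (ContinuousMap.dist_apply_le_dist t).trans (hball h1).le
    simpa [dist_eq_norm] using h2
  have hvt : v t ∈ Metric.ball (u t) δ :=
    lt_of_le_of_lt (ContinuousMap.dist_apply_le_dist t) hv
  have := (convex_ball (u t) δ).norm_image_sub_le_of_norm_hasFDerivWithin_le'
    (fun x _ => (hf x).hasFDerivWithinAt) hut (Metric.mem_ball_self hδ) hvt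
  refine this.trans ?_
  gcongr
  exact (v - u).norm_coe_le_norm t

/-- The derivative is postcomposition with `f'` followed by a bounded linear map, which allows
induction on `n`. The codomain changes to `E →L[ℝ] F`, hence the quantification over `F` and the
common universe. -/
theorem ContinuousMap.contDiff_postcomp_nat (n : ℕ) :
    ∀ {F : Type u} [NormedAddCommGroup F] [NormedSpace ℝ F] (f : C(E, F)), ContDiff ℝ n f →
      ContDiff ℝ n (fun v : C(K, E) => f.comp v) := by
  induction n with
  | zero =>
    intro F _ _ f _
    exact contDiff_zero.2 (ContinuousMap.continuous_postcomp f)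
  | succ n ih =>
    intro F _ _ f hf
    obtain ⟨f', hf', hd⟩ := contDiff_succ_iff_hasFDerivAt.1 hf
    refine contDiff_succ_iff_hasFDerivAt.2 ⟨_, ?_,
      ContinuousMap.hasFDerivAt_postcomp f ⟨f', hf'.continuous⟩ hd⟩
    exact (ContinuousMap.pointwiseApplyL K E F).contDiff.comp (ih ⟨f', hf'.continuous⟩ hf')

theorem ContinuousMap.contDiff_postcomp (f : C(E, F)) (hf : ContDiff ℝ ∞ f) :
    ContDiff ℝ ∞ (fun v : C(K, E) => f.comp v) :=
  contDiff_infty.2 fun n => ContinuousMap.contDiff_postcomp_nat n f (contDiff_infty.1 hf n)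

end Nemytskii

/-! ### Integration from `0` as a bounded operator on `C([-1, 1], X)`. -/

section Integration

variable {X : Type*} [NormedAddCommGroup X] [NormedSpace ℝ X]

/-- The primitive vanishing at `0` of a continuous function on `[-1, 1]`, as a bounded linear
operator. -/
noncomputable def ContinuousMap.primitiveL (X : Type*) [NormedAddCommGroup X] [NormedSpace ℝ X] :
    C(Set.Icc (-1 : ℝ) 1, X) →L[ℝ] C(Set.Icc (-1 : ℝ) 1, X) :=
  have hint (v : C(Set.Icc (-1 : ℝ) 1, X)) (a b : ℝ) : IntervalIntegrable
      (Set.IccExtend (by norm_num : (-1 : ℝ) ≤ 1) v) MeasureTheory.volume a b :=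
    (v.continuous.Icc_extend').intervalIntegrable a b
  LinearMap.mkContinuous
    { toFun := fun v => ⟨fun t => ∫ r in (0 : ℝ)..t,
        Set.IccExtend (by norm_num : (-1 : ℝ) ≤ 1) v r,
        (intervalIntegral.continuous_primitive (hint v) 0).comp continuous_subtype_val⟩
      map_add' := fun v w => by
        ext t
        simpa [Set.IccExtend, Function.comp_def] using
          intervalIntegral.integral_add (hint v 0 t) (hint w 0 t)
      map_smul' := fun c v => by
        ext t
        simp [Set.IccExtend] } 1
    (fun v => by
      rw [ContinuousMap.norm_le _ (by positivity)]
      intro t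
      have h1 := intervalIntegral.norm_integral_le_of_norm_le_const (a := 0) (b := (t : ℝ))
        (C := ‖v‖) (f := Set.IccExtend (by norm_num : (-1 : ℝ) ≤ 1) v)
        (fun x _ => v.norm_coe_le_norm _)
      refine h1.trans ?_
      rw [one_mul, sub_zero]
      exact mul_le_of_le_one_right (norm_nonneg _) (abs_le.2 t.2))

theorem ContinuousMap.primitiveL_apply (v : C(Set.Icc (-1 : ℝ) 1, X)) (t : Set.Icc (-1 : ℝ) 1) :
    ContinuousMap.primitiveL X v t =
      ∫ r in (0 : ℝ)..t, Set.IccExtend (by norm_num : (-1 : ℝ) ≤ 1) v r := rfl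

end Integration

/-! ### A local inverse that is smooth on its whole domain. -/

section InverseFunction

open Set Filter Topology

theorem exists_openPartialHomeomorph_contDiffOn_symm {E : Type*} [NormedAddCommGroup E]
    [NormedSpace ℝ E] [CompleteSpace E] {f : E → E} (hf : ContDiff ℝ ∞ f) {a : E} {e : E ≃L[ℝ] E}
    (he : HasFDerivAt f (e : E →L[ℝ] E) a) :
    ∃ Θ : OpenPartialHomeomorph E E, (Θ : E → E) = f ∧ a ∈ Θ.source ∧
      ContDiffOn ℝ ∞ Θ.symm Θ.target := by
  have hn : (∞ : WithTop ℕ∞) ≠ 0 := by simp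
  let Θ₀ := hf.contDiffAt.toOpenPartialHomeomorph f he hn
  -- Invertible operators form a neighbourhood of `e`. Restricting to `S` makes the derivative
  -- invertible at every point of the source, not only at `a`.
  let S : Set E := fderiv ℝ f ⁻¹' interior (range ((↑) : (E ≃L[ℝ] E) → E →L[ℝ] E))
  have hS : IsOpen S := isOpen_interior.preimage (hf.continuous_fderiv (by simp))
  have haS : a ∈ S := by
    rw [mem_preimage, he.fderiv]
    exact mem_interior_iff_mem_nhds.2 e.nhds
  refine ⟨Θ₀.restrOpen S hS, rfl,
    ⟨hf.contDiffAt.mem_toOpenPartialHomeomorph_source he hn, haS⟩, ?_⟩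
  intro y hy
  have hmem := (Θ₀.restrOpen S hS).map_target hy
  have hmem' : fderiv ℝ f ((Θ₀.restrOpen S hS).symm y) ∈
      range ((↑) : (E ≃L[ℝ] E) → E →L[ℝ] E) := interior_subset hmem.2
  obtain ⟨e', he'⟩ := hmem'
  refine ((Θ₀.restrOpen S hS).contDiffAt_symm (f₀' := e') hy ?_ hf.contDiffAt).contDiffWithinAt
  rw [he']
  exact (hf.differentiable (by simp) _).hasFDerivAt

end InverseFunction

/-! ### Smooth local flows on Banach spaces. -/

section Flow

open Set Filter Topology

universe u

/-- The constant functions, as a bounded linear map. -/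
noncomputable def ContinuousMap.constantL (X : Type*) [NormedAddCommGroup X] [NormedSpace ℝ X] :
    X →L[ℝ] C(Set.Icc (-1 : ℝ) 1, X) :=
  LinearMap.mkContinuous
    { toFun := fun x => ContinuousMap.const _ x
      map_add' := fun _ _ => rfl
      map_smul' := fun _ _ => rfl } 1
    (fun x => by
      rw [ContinuousMap.norm_le _ (by positivity)]
      intro t
      rw [one_mul]
      exact le_rfl)

/-- The map whose zero set describes the solutions on `[-1, 1]` of `u' = s f(u)`, `u(0) = x`,
completed by the parameters `(x, s)`. -/
noncomputable def integralEquation {X : Type u} [NormedAddCommGroup X] [NormedSpace ℝ X]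
    (f : C(X, X)) (q : C(Set.Icc (-1 : ℝ) 1, X) × X × ℝ) : C(Set.Icc (-1 : ℝ) 1, X) × X × ℝ :=
  (q.1 - ContinuousMap.constantL X q.2.1 - q.2.2 • ContinuousMap.primitiveL X (f.comp q.1), q.2)

variable {X : Type u} [NormedAddCommGroup X] [NormedSpace ℝ X]

theorem contDiff_integralEquation (f : C(X, X)) (hf : ContDiff ℝ ∞ f) :
    ContDiff ℝ ∞ (integralEquation f) := by
  have h1 : ContDiff ℝ ∞ (fun q : C(Set.Icc (-1 : ℝ) 1, X) × X × ℝ =>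
      ContinuousMap.primitiveL X (f.comp q.1)) :=
    (ContinuousMap.primitiveL X).contDiff.comp
      ((ContinuousMap.contDiff_postcomp f hf).comp contDiff_fst)
  have h2 : ContDiff ℝ ∞ (fun q : C(Set.Icc (-1 : ℝ) 1, X) × X × ℝ =>
      ContinuousMap.constantL X q.2.1) :=
    (ContinuousMap.constantL X).contDiff.comp (contDiff_fst.comp contDiff_snd)
  exact ((contDiff_fst.sub h2).sub ((contDiff_snd.comp contDiff_snd).smul h1)).prodMk contDiff_snd

/-- The linear map `(h, ξ, σ) ↦ ξ + σ c`. -/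
noncomputable def integralEquationShearTerm (c : C(Set.Icc (-1 : ℝ) 1, X)) :
    (C(Set.Icc (-1 : ℝ) 1, X) × X × ℝ) →L[ℝ] C(Set.Icc (-1 : ℝ) 1, X) :=
  ((ContinuousMap.constantL X).comp (ContinuousLinearMap.fst ℝ X ℝ) +
    (ContinuousLinearMap.snd ℝ X ℝ).smulRight c).comp
      (ContinuousLinearMap.snd ℝ C(Set.Icc (-1 : ℝ) 1, X) (X × ℝ))

/-- The shear `(h, ξ, σ) ↦ (h - ξ - σ c, ξ, σ)`. -/
noncomputable def integralEquationShear (c : C(Set.Icc (-1 : ℝ) 1, X)) :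
    (C(Set.Icc (-1 : ℝ) 1, X) × X × ℝ) ≃L[ℝ] (C(Set.Icc (-1 : ℝ) 1, X) × X × ℝ) :=
  ContinuousLinearEquiv.equivOfInverse
    (ContinuousLinearMap.prod
      (ContinuousLinearMap.fst ℝ C(Set.Icc (-1 : ℝ) 1, X) (X × ℝ) - integralEquationShearTerm c)
      (ContinuousLinearMap.snd ℝ C(Set.Icc (-1 : ℝ) 1, X) (X × ℝ)))
    (ContinuousLinearMap.prod
      (ContinuousLinearMap.fst ℝ C(Set.Icc (-1 : ℝ) 1, X) (X × ℝ) + integralEquationShearTerm c)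
      (ContinuousLinearMap.snd ℝ C(Set.Icc (-1 : ℝ) 1, X) (X × ℝ)))
    (fun q => by ext <;> simp [integralEquationShearTerm])
    (fun q => by ext <;> simp [integralEquationShearTerm])

/-- At `s = 0` the derivative of `f` drops out of the product rule. What remains is a shear, whose
inverse is explicit. -/
theorem hasFDerivAt_integralEquation (f : C(X, X)) (hf : ContDiff ℝ ∞ f)
    (u : C(Set.Icc (-1 : ℝ) 1, X)) (x : X) :
    HasFDerivAt (integralEquation f)
      (integralEquationShear (ContinuousMap.primitiveL X (f.comp u)) :
        (C(Set.Icc (-1 : ℝ) 1, X) × X × ℝ) →L[ℝ] (C(Set.Icc (-1 : ℝ) 1, X) × X × ℝ))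
      (u, x, 0) := by
  let π₁ := ContinuousLinearMap.fst ℝ C(Set.Icc (-1 : ℝ) 1, X) (X × ℝ)
  let π₂ := ContinuousLinearMap.snd ℝ C(Set.Icc (-1 : ℝ) 1, X) (X × ℝ)
  have h1 : DifferentiableAt ℝ (fun q : C(Set.Icc (-1 : ℝ) 1, X) × X × ℝ =>
      ContinuousMap.primitiveL X (f.comp q.1)) (u, x, 0) :=
    (((ContinuousMap.primitiveL X).contDiff.comp
      ((ContinuousMap.contDiff_postcomp f hf).comp contDiff_fst)).differentiable (n := ∞)
        (by simp)) _
  have h2 : HasFDerivAt (fun q : C(Set.Icc (-1 : ℝ) 1, X) × X × ℝ => q.2.2)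
      ((ContinuousLinearMap.snd ℝ X ℝ).comp π₂) (u, x, 0) :=
    ContinuousLinearMap.hasFDerivAt ((ContinuousLinearMap.snd ℝ X ℝ).comp π₂)
  have h3 : HasFDerivAt (fun q : C(Set.Icc (-1 : ℝ) 1, X) × X × ℝ =>
      q.1 - ContinuousMap.constantL X q.2.1)
      (π₁ - (ContinuousMap.constantL X).comp ((ContinuousLinearMap.fst ℝ X ℝ).comp π₂))
      (u, x, 0) :=
    ContinuousLinearMap.hasFDerivAt
      (π₁ - (ContinuousMap.constantL X).comp ((ContinuousLinearMap.fst ℝ X ℝ).comp π₂))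
  have h4 := (h3.sub (h2.smul h1.hasFDerivAt)).prodMk (ContinuousLinearMap.hasFDerivAt π₂)
  refine h4.congr_fderiv ?_
  apply ContinuousLinearMap.ext
  intro q
  ext <;> simp [integralEquationShear, integralEquationShearTerm, π₁, π₂, sub_sub]

/-- The right end point of `[-1, 1]`. -/
def symmetricIccEnd : Set.Icc (-1 : ℝ) 1 := ⟨1, by norm_num⟩

/-- The inverse function theorem at the constant solution with `s = 0` yields the solutions for
small `s`. The last clause, by rescaling time, makes the value at time `1` for the parameter `s` a
flow in `s`. -/
theorem exists_solution_operator [CompleteSpace X] (f : C(X, X)) (hf : ContDiff ℝ ∞ f) (x₀ : X) :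
    ∃ (u : X × ℝ → C(Set.Icc (-1 : ℝ) 1, X)) (δ : ℝ), 0 < δ ∧
      ContDiffOn ℝ ∞ u (Metric.ball x₀ δ ×ˢ Metric.ball 0 δ) ∧
      (∀ x ∈ Metric.ball x₀ δ, ∀ s ∈ Metric.ball (0 : ℝ) δ,
        u (x, s) = ContinuousMap.constantL X x +
          s • ContinuousMap.primitiveL X (f.comp (u (x, s)))) ∧
      ∀ x ∈ Metric.ball x₀ δ, ∀ s ∈ Metric.ball (0 : ℝ) δ, ∀ l : Set.Icc (-1 : ℝ) 1,
        u (x, l * s) symmetricIccEnd = u (x, s) l := by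
  obtain ⟨Θ, hΘ, ha, hsmooth⟩ := exists_openPartialHomeomorph_contDiffOn_symm
    (contDiff_integralEquation f hf)
    (hasFDerivAt_integralEquation f hf (ContinuousMap.constantL X x₀) x₀)
  have hΘa : Θ (ContinuousMap.constantL X x₀, x₀, 0) = (0, x₀, 0) := by
    simp [hΘ, integralEquation]
  obtain ⟨η, hη, hηs⟩ := Metric.isOpen_iff.1 Θ.open_source _ ha
  have htar : ((0 : C(Set.Icc (-1 : ℝ) 1, X)), x₀, (0 : ℝ)) ∈ Θ.target := hΘa ▸ Θ.map_source ha
  have hsym : Θ.symm (0, x₀, 0) = (ContinuousMap.constantL X x₀, x₀, 0) := by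
    rw [← hΘa, Θ.left_inv ha]
  let j : X × ℝ → C(Set.Icc (-1 : ℝ) 1, X) × X × ℝ := fun p => (0, p.1, p.2)
  have hj : ContDiff ℝ ∞ j := contDiff_const.prodMk contDiff_id
  have hcont : ContinuousAt (fun p => Θ.symm (j p)) (x₀, (0 : ℝ)) :=
    (Θ.continuousAt_symm htar).comp (f := j) hj.continuous.continuousAt
  have hev : ∀ᶠ p in 𝓝 (x₀, (0 : ℝ)), j p ∈ Θ.target ∧
      Θ.symm (j p) ∈ Metric.ball (ContinuousMap.constantL X x₀, x₀, (0 : ℝ)) η := by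
    refine (hj.continuous.continuousAt.eventually_mem (Θ.open_target.mem_nhds htar)).and
      (hcont.eventually_mem ?_)
    change Metric.ball _ η ∈ 𝓝 (Θ.symm (0, x₀, 0))
    rw [hsym]
    exact Metric.ball_mem_nhds _ hη
  obtain ⟨δ, hδ, hball⟩ := Metric.eventually_nhds_iff_ball.1 hev
  have hin : ∀ x ∈ Metric.ball x₀ δ, ∀ s ∈ Metric.ball (0 : ℝ) δ,
      (x, s) ∈ Metric.ball (x₀, (0 : ℝ)) δ := fun x hx s hs => by
    rw [← ball_prod_same]; exact ⟨hx, hs⟩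
  have hsnd : ∀ x ∈ Metric.ball x₀ δ, ∀ s ∈ Metric.ball (0 : ℝ) δ,
      (Θ.symm (j (x, s))).2 = (x, s) ∧
      (Θ.symm (j (x, s))).1 = ContinuousMap.constantL X x +
        s • ContinuousMap.primitiveL X (f.comp (Θ.symm (j (x, s))).1) := by
    intro x hx s hs
    have h := Θ.right_inv (hball _ (hin x hx s hs)).1
    rw [hΘ] at h
    have h2 : (Θ.symm (j (x, s))).2 = (x, s) := congrArg Prod.snd h
    refine ⟨h2, ?_⟩
    have h1 : (Θ.symm (j (x, s))).1 - ContinuousMap.constantL X (Θ.symm (j (x, s))).2.1 -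
      (Θ.symm (j (x, s))).2.2 • ContinuousMap.primitiveL X (f.comp (Θ.symm (j (x, s))).1) = 0 :=
      congrArg Prod.fst h
    rw [h2, sub_sub, sub_eq_zero] at h1
    exact h1
  refine ⟨fun p => (Θ.symm (j p)).1, δ, hδ, ?_, fun x hx s hs => (hsnd x hx s hs).2, ?_⟩
  · refine contDiff_fst.comp_contDiffOn (hsmooth.comp hj.contDiffOn ?_)
    rintro ⟨x, s⟩ ⟨hx, hs⟩
    exact (hball _ (hin x hx s hs)).1
  · intro x hx s hs l
    have hls : (l : ℝ) * s ∈ Metric.ball (0 : ℝ) δ := by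
      rw [mem_ball_zero_iff, norm_mul]
      rw [mem_ball_zero_iff] at hs
      have := abs_le.2 l.2
      exact lt_of_le_of_lt (mul_le_of_le_one_left (norm_nonneg s) this) hs
    have hmul : ∀ r : Set.Icc (-1 : ℝ) 1, (l : ℝ) * r ∈ Set.Icc (-1 : ℝ) 1 := fun r => by
      rw [mem_Icc, ← abs_le, abs_mul]
      exact mul_le_one₀ (abs_le.2 l.2) (abs_nonneg _) (abs_le.2 r.2)
    -- The curve `r ↦ w (l r)` solves the equation with parameter `l s`. Composition with `m` does
    -- not increase the sup distance to the constant `x₀`, so it stays in the source of `Θ`, and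
    -- injectivity there identifies it with `u (x, l s)`.
    let m : C(Set.Icc (-1 : ℝ) 1, Set.Icc (-1 : ℝ) 1) := ⟨fun r => ⟨l * r, hmul r⟩, by fun_prop⟩
    obtain ⟨hs2, hs1⟩ := hsnd x hx s hs
    set w := (Θ.symm (j (x, s))).1 with hw
    have hwball : (w, x, s) ∈ Metric.ball (ContinuousMap.constantL X x₀, x₀, (0 : ℝ)) η := by
      have := (hball _ (hin x hx s hs)).2
      rwa [← hs2]
    rw [← ball_prod_same, ← ball_prod_same] at hwball
    have hxη : x ∈ Metric.ball x₀ η := hwball.2.1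
    have hmball : (w.comp m, x, (l : ℝ) * s) ∈ Θ.source := by
      apply hηs
      rw [← ball_prod_same, ← ball_prod_same]
      refine ⟨?_, hxη, ?_⟩
      · have h1 := hwball.1
        rw [Metric.mem_ball, dist_eq_norm] at h1 ⊢
        refine lt_of_le_of_lt ((ContinuousMap.norm_le _ (norm_nonneg _)).2 fun r => ?_) h1
        exact (w - ContinuousMap.constantL X x₀).norm_coe_le_norm (m r)
      · have h1 := hwball.2.2
        rw [mem_ball_zero_iff] at h1 ⊢
        rw [norm_mul]
        exact lt_of_le_of_lt (mul_le_of_le_one_left (norm_nonneg s) (abs_le.2 l.2)) h1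
    have heq : w.comp m = ContinuousMap.constantL X x +
        ((l : ℝ) * s) • ContinuousMap.primitiveL X (f.comp (w.comp m)) := by
      ext r
      have h1 := DFunLike.congr_fun hs1 (m r)
      rw [ContinuousMap.add_apply, ContinuousMap.smul_apply, ContinuousMap.primitiveL_apply] at h1
      rw [ContinuousMap.add_apply, ContinuousMap.smul_apply, ContinuousMap.primitiveL_apply,
        mul_comm, mul_smul]
      refine h1.trans ?_
      have h2 := intervalIntegral.smul_integral_comp_mul_left (a := 0) (b := (r : ℝ))
        (Set.IccExtend (by norm_num : (-1 : ℝ) ≤ 1) (f.comp w)) (l : ℝ)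
      rw [mul_zero] at h2
      refine congrArg (fun z => x + s • z) (h2.symm.trans (congrArg (fun z => (l : ℝ) • z) ?_))
      refine intervalIntegral.integral_congr fun y hy => ?_
      have hy' : y ∈ Set.Icc (-1 : ℝ) 1 := by
        refine ordConnected_Icc.uIcc_subset (by norm_num) r.2 hy
      rw [Set.IccExtend_of_mem _ _ hy', Set.IccExtend_of_mem _ _ (hmul ⟨y, hy'⟩)]
      rfl
    have hΘw : Θ (w.comp m, x, (l : ℝ) * s) = j (x, l * s) := by
      rw [hΘ]
      refine Prod.ext ?_ rfl
      change w.comp m - ContinuousMap.constantL X x -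
        ((l : ℝ) * s) • ContinuousMap.primitiveL X (f.comp (w.comp m)) = 0
      rw [sub_sub, ← heq, sub_self]
    have hfin : Θ.symm (j (x, l * s)) = (w.comp m, x, (l : ℝ) * s) := by
      rw [← hΘw, Θ.left_inv hmball]
    change (Θ.symm (j (x, l * s))).1 symmetricIccEnd = w l
    rw [hfin]
    change w (m symmetricIccEnd) = w l
    congr 1
    exact Subtype.ext (mul_one _)

/-- Smooth local flow of a smooth vector field on a Banach space. -/
theorem exists_contDiffOn_flow [CompleteSpace X] {f : X → X} (hf : ContDiff ℝ ∞ f) (x₀ : X) :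
    ∃ (Fl : X × ℝ → X) (V : Set X) (δ : ℝ), 0 < δ ∧ IsOpen V ∧ x₀ ∈ V ∧
      ContDiffOn ℝ ∞ Fl (V ×ˢ Ioo (-δ) δ) ∧ (∀ x ∈ V, Fl (x, 0) = x) ∧
      ∀ x ∈ V, ∀ t ∈ Ioo (-δ) δ, HasDerivAt (fun t => Fl (x, t)) (f (Fl (x, t))) t := by
  obtain ⟨u, δ, hδ, hsm, hsol, hscale⟩ := exists_solution_operator ⟨f, hf.continuous⟩ hf x₀
  have hmemδ : δ / 2 ∈ Metric.ball (0 : ℝ) δ := by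
    rw [mem_ball_zero_iff, Real.norm_eq_abs, abs_of_pos (by positivity)]; linarith
  -- Here `t` enters only through the upper limit of an integral along one fixed solution, so the
  -- fundamental theorem of calculus gives the time derivative. Joint smoothness is read off from
  -- the left-hand side instead.
  have hkey : ∀ x ∈ Metric.ball x₀ δ, ∀ t ∈ Ioo (-(δ / 2)) (δ / 2),
      u (x, t) symmetricIccEnd = x + (δ / 2) • ∫ r in (0 : ℝ)..(t / (δ / 2)),
        f (Set.IccExtend (by norm_num : (-1 : ℝ) ≤ 1) (u (x, δ / 2)) r) := by
    intro x hx t ht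
    have hl : t / (δ / 2) ∈ Set.Icc (-1 : ℝ) 1 := by
      rw [mem_Icc, le_div_iff₀ (by positivity), div_le_iff₀ (by positivity)]
      constructor <;> linarith [ht.1, ht.2]
    have h1 := hscale x hx _ hmemδ ⟨_, hl⟩
    rw [div_mul_cancel₀ _ (by positivity : δ / 2 ≠ 0)] at h1
    rw [h1]
    exact DFunLike.congr_fun (hsol x hx _ hmemδ) ⟨_, hl⟩
  have hkey2 : ∀ x ∈ Metric.ball x₀ δ, ∀ t ∈ Ioo (-(δ / 2)) (δ / 2),
      Set.IccExtend (by norm_num : (-1 : ℝ) ≤ 1) (u (x, δ / 2)) (t / (δ / 2)) = u (x, t) symmetricIccEnd := by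
    intro x hx t ht
    have hl : t / (δ / 2) ∈ Set.Icc (-1 : ℝ) 1 := by
      rw [mem_Icc, le_div_iff₀ (by positivity), div_le_iff₀ (by positivity)]
      constructor <;> linarith [ht.1, ht.2]
    have h1 := hscale x hx _ hmemδ ⟨_, hl⟩
    rw [div_mul_cancel₀ _ (by positivity : δ / 2 ≠ 0)] at h1
    rw [h1, Set.IccExtend_of_mem _ _ hl]
  refine ⟨fun p => u p symmetricIccEnd, Metric.ball x₀ δ, δ / 2, by positivity, Metric.isOpen_ball,
    Metric.mem_ball_self hδ, ?_, ?_, ?_⟩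
  · refine (ContinuousMap.evalCLM ℝ symmetricIccEnd).contDiff.comp_contDiffOn
      (hsm.mono (prod_mono_right fun t ht => ?_))
    rw [mem_ball_zero_iff, Real.norm_eq_abs, abs_lt]
    constructor <;> linarith [ht.1, ht.2]
  · intro x hx
    have := hkey x hx 0 ⟨by linarith, by linarith⟩
    simpa using this
  · intro x hx t ht
    have hc : Continuous (fun r =>
        f (Set.IccExtend (by norm_num : (-1 : ℝ) ≤ 1) (u (x, δ / 2)) r)) :=
      hf.continuous.comp (u (x, δ / 2)).continuous.Icc_extend'
    have h1 := intervalIntegral.integral_hasDerivAt_right (hc.intervalIntegrable 0 (t / (δ / 2)))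
      (hc.stronglyMeasurableAtFilter _ _) hc.continuousAt
    have h2 : HasDerivAt (fun t : ℝ => t / (δ / 2)) (1 / (δ / 2)) t :=
      (hasDerivAt_id t).div_const _
    have h3 := ((h1.scomp t h2).const_smul (δ / 2)).const_add x
    rw [smul_smul, mul_one_div_cancel (by positivity : δ / 2 ≠ 0), one_smul, hkey2 x hx t ht] at h3
    refine h3.congr_of_eventuallyEq ?_
    filter_upwards [isOpen_Ioo.mem_nhds ht] with t' ht'
    exact hkey x hx t' ht'

end Flow

/-! ### Nonautonomous equations with parameters. -/

section ParametricODE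

open Set Filter Topology

/-- Multiplication by a bump function produces a globally defined vector field, as the flow theorem
requires. -/
theorem ContDiffOn.exists_contDiff_eventuallyEq {X Y : Type*} [NormedAddCommGroup X]
    [NormedSpace ℝ X] [FiniteDimensional ℝ X] [NormedAddCommGroup Y] [NormedSpace ℝ Y]
    {W : X → Y} {U : Set X} (hU : IsOpen U) (hW : ContDiffOn ℝ ∞ W U) {x : X} (hx : x ∈ U) :
    ∃ W' : X → Y, ContDiff ℝ ∞ W' ∧ ∃ S : Set X, IsOpen S ∧ x ∈ S ∧ S ⊆ U ∧ EqOn W' W S := by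
  obtain ⟨r, hr, hball⟩ := Metric.isOpen_iff.1 hU x hx
  let χ : ContDiffBump x := ⟨r / 4, r / 2, by positivity, by linarith⟩
  have hsupp : tsupport χ ⊆ U := by
    rw [χ.tsupport_eq]
    exact (Metric.closedBall_subset_ball (show r / 2 < r by linarith)).trans hball
  refine ⟨fun y => χ y • W y, ?_, Metric.ball x (r / 4), Metric.isOpen_ball,
    Metric.mem_ball_self (by positivity),
    (Metric.ball_subset_ball (by linarith)).trans hball, ?_⟩
  · rw [contDiff_iff_contDiffAt]
    intro y
    by_cases hy : y ∈ U
    · exact χ.contDiff.contDiffAt.smul (hW.contDiffAt (hU.mem_nhds hy))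
    · have : (fun y => χ y • W y) =ᶠ[𝓝 y] fun _ => 0 := by
        filter_upwards [(isClosed_tsupport χ).isOpen_compl.mem_nhds fun h => hy (hsupp h)]
          with z hz
        rw [image_eq_zero_of_notMem_tsupport hz, zero_smul]
      exact contDiffAt_const.congr_of_eventuallyEq this
  · intro y hy
    change χ y • W y = W y
    rw [χ.one_of_mem_closedBall (Metric.ball_subset_closedBall hy), one_smul]

/-- Local solutions of an ordinary differential equation depend smoothly on time and parameters. -/
theorem exists_contDiffOn_parametric_solution {E P : Type*} [NormedAddCommGroup E]
    [NormedSpace ℝ E] [FiniteDimensional ℝ E] [NormedAddCommGroup P] [NormedSpace ℝ P]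
    [FiniteDimensional ℝ P] {W : E × P × ℝ → E} {U : Set (E × P × ℝ)} (hU : IsOpen U)
    (hW : ContDiffOn ℝ ∞ W U) {z₀ : P → E} {A : Set P} (hA : IsOpen A)
    (hz₀ : ContDiffOn ℝ ∞ z₀ A) {p₀ : P} (hp₀ : p₀ ∈ A) {t₀ : ℝ} (hmem : (z₀ p₀, p₀, t₀) ∈ U) :
    ∃ (z : P × ℝ → E) (V : Set P) (δ : ℝ), IsOpen V ∧ p₀ ∈ V ∧ V ⊆ A ∧ 0 < δ ∧
      ContDiffOn ℝ ∞ z (V ×ˢ Ioo (t₀ - δ) (t₀ + δ)) ∧ (∀ p ∈ V, z (p, t₀) = z₀ p) ∧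
      ∀ p ∈ V, ∀ t ∈ Ioo (t₀ - δ) (t₀ + δ), (z (p, t), p, t) ∈ U ∧
        HasDerivAt (fun t => z (p, t)) (W (z (p, t), p, t)) t := by
  obtain ⟨W', hW', S, hS, hxS, hSU, hWS⟩ := hW.exists_contDiff_eventuallyEq hU hmem
  -- Parameters and time become state variables: parameters stand still and time runs with unit
  -- speed.
  let f : E × P × ℝ → E × P × ℝ := fun q => (W' q, 0, 1)
  have hf : ContDiff ℝ ∞ f := hW'.prodMk contDiff_const
  obtain ⟨Fl, V, δ, hδ, hV, hxV, hFl, hFl0, hder⟩ := exists_contDiffOn_flow hf (z₀ p₀, p₀, t₀)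
  let ι : P × ℝ → (E × P × ℝ) × ℝ := fun q => ((z₀ q.1, q.1, t₀), q.2 - t₀)
  have hι : ContDiffOn ℝ ∞ ι (A ×ˢ univ) := by
    refine ((hz₀.comp contDiffOn_fst fun q hq => hq.1).prodMk
      (contDiffOn_fst.prodMk contDiffOn_const)).prodMk (contDiffOn_snd.sub contDiffOn_const)
  have hbase : ι (p₀, t₀) = ((z₀ p₀, p₀, t₀), 0) := by simp [ι]
  have hopen : IsOpen (V ×ˢ Ioo (-δ) δ) := hV.prod isOpen_Ioo
  have hmemι : ι (p₀, t₀) ∈ V ×ˢ Ioo (-δ) δ := by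
    rw [hbase]; exact ⟨hxV, by constructor <;> linarith⟩
  have hAat : A ×ˢ (univ : Set ℝ) ∈ 𝓝 (p₀, t₀) := (hA.prod isOpen_univ).mem_nhds ⟨hp₀, trivial⟩
  have hιc : ContinuousAt ι (p₀, t₀) := hι.continuousOn.continuousAt hAat
  have hFc : ContinuousAt (fun q => Fl (ι q)) (p₀, t₀) :=
    ContinuousAt.comp (f := ι) (hFl.continuousOn.continuousAt (hopen.mem_nhds hmemι)) hιc
  have hev : ∀ᶠ q in 𝓝 (p₀, t₀), q ∈ A ×ˢ (univ : Set ℝ) ∧ ι q ∈ V ×ˢ Ioo (-δ) δ ∧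
      Fl (ι q) ∈ S := by
    refine Filter.Eventually.and hAat ((hιc.eventually_mem (hopen.mem_nhds hmemι)).and
      (hFc.eventually_mem ?_))
    rw [hbase, hFl0 _ hxV]
    exact hS.mem_nhds hxS
  obtain ⟨η, hη, hball⟩ := Metric.eventually_nhds_iff_ball.1 hev
  have hin : ∀ p ∈ Metric.ball p₀ η, ∀ t ∈ Ioo (t₀ - η) (t₀ + η),
      (p, t) ∈ Metric.ball (p₀, t₀) η := fun p hp t ht => by
    rw [← ball_prod_same, Real.ball_eq_Ioo]; exact ⟨hp, ht⟩
  have ht₀ : t₀ ∈ Ioo (t₀ - η) (t₀ + η) := by constructor <;> linarith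
  have hd : ∀ p ∈ Metric.ball p₀ η, ∀ t ∈ Ioo (t₀ - η) (t₀ + η),
      HasDerivAt (fun t => Fl (ι (p, t))) (f (Fl (ι (p, t)))) t := by
    intro p hp t ht
    have h := hball _ (hin p hp t ht)
    exact HasDerivAt.comp_sub_const (f := fun s => Fl ((z₀ p, p, t₀), s)) t t₀
      (hder _ h.2.1.1 _ h.2.1.2)
  have h0 : ∀ p ∈ Metric.ball p₀ η, Fl (ι (p, t₀)) = (z₀ p, p, t₀) := by
    intro p hp
    have h := hball _ (hin p hp t₀ ht₀)
    have := hFl0 _ h.2.1.1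
    simpa [ι] using this
  have hsnd : ∀ p ∈ Metric.ball p₀ η, ∀ t ∈ Ioo (t₀ - η) (t₀ + η),
      (Fl (ι (p, t))).2 = (p, t) := by
    intro p hp t ht
    have h1 : ∀ s ∈ Ioo (t₀ - η) (t₀ + η),
        HasDerivAt (fun t => (Fl (ι (p, t))).2 - (0, t)) (0 : P × ℝ) s := by
      intro s hs
      have := (hasFDerivAt_snd.comp_hasDerivAt s (hd p hp s hs)).sub
        ((hasDerivAt_const s (0 : P)).prodMk (hasDerivAt_id s))
      exact this.congr_deriv (by simp [f])
    have h2 := isOpen_Ioo.is_const_of_deriv_eq_zero isPreconnected_Ioo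
      (fun s hs => (h1 s hs).differentiableAt.differentiableWithinAt)
      (fun s hs => (h1 s hs).deriv) ht ht₀
    simp only [h0 p hp] at h2
    have h3 := sub_eq_iff_eq_add.1 h2
    rw [h3]
    simp
  refine ⟨fun q => (Fl (ι q)).1, Metric.ball p₀ η, η, Metric.isOpen_ball,
    Metric.mem_ball_self hη, fun p hp => (hball _ (hin p hp t₀ ht₀)).1.1, hη, ?_,
    fun p hp => by simp only [h0 p hp], ?_⟩
  · refine contDiff_fst.comp_contDiffOn (hFl.comp (hι.mono ?_) ?_)
    · rintro ⟨p, t⟩ ⟨hp, ht⟩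
      exact (hball _ (hin p hp t ht)).1
    · rintro ⟨p, t⟩ ⟨hp, ht⟩
      exact (hball _ (hin p hp t ht)).2.1
  · intro p hp t ht
    have hmemS := (hball _ (hin p hp t ht)).2.2
    have heq : Fl (ι (p, t)) = ((Fl (ι (p, t))).1, p, t) :=
      Prod.ext rfl (hsnd p hp t ht)
    rw [← heq]
    refine ⟨hSU hmemS, ?_⟩
    rw [← hWS hmemS]
    exact hasFDerivAt_fst.comp_hasDerivAt t (hd p hp t ht)

end ParametricODE

/-! ### Velocities of curves in manifolds, without Hausdorff assumptions. -/

section Velocity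

open Set Filter Topology

variable {E H M E' H' M' E'' H'' M'' : Type*}
  [NormedAddCommGroup E] [NormedSpace ℝ E] [TopologicalSpace H] {I : ModelWithCorners ℝ E H}
  [TopologicalSpace M] [ChartedSpace H M]
  [NormedAddCommGroup E'] [NormedSpace ℝ E'] [TopologicalSpace H'] {I' : ModelWithCorners ℝ E' H'}
  [TopologicalSpace M'] [ChartedSpace H' M']
  [NormedAddCommGroup E''] [NormedSpace ℝ E''] [TopologicalSpace H'']
  {I'' : ModelWithCorners ℝ E'' H''} [TopologicalSpace M''] [ChartedSpace H'' M'']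

/-- The curve `γ` has the velocity `v` at the time `e`, where tangent vectors are identified with
vectors of the model space. -/
def HasVelocity (I : ModelWithCorners ℝ E H) (γ : ℝ → M) (v : E) (e : ℝ) : Prop :=
  HasMFDerivAt 𝓘(ℝ, ℝ) I γ e (ContinuousLinearMap.toSpanSingleton ℝ v : ℝ →L[ℝ] E)

theorem exists_hasMFDerivWithinAt {F : M → M'} {S : Set M} {p : M}
    (hF : MDifferentiableWithinAt I I' F S p) :
    ∃ L : E →L[ℝ] E', HasMFDerivWithinAt I I' F S p L :=
  ⟨mfderivWithin I I' F S p, hF.hasMFDerivWithinAt⟩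

theorem exists_hasMFDerivAt {F : M → M'} {p : M} (hF : MDifferentiableAt I I' F p) :
    ∃ L : E →L[ℝ] E', HasMFDerivAt I I' F p L :=
  ⟨mfderiv I I' F p, hF.hasMFDerivAt⟩

namespace HasVelocity

variable {γ γ' : ℝ → M} {v w : E} {e : ℝ}

theorem mdifferentiableAt (h : HasVelocity I γ v e) : MDifferentiableAt 𝓘(ℝ, ℝ) I γ e :=
  HasMFDerivAt.mdifferentiableAt h

theorem continuousAt (h : HasVelocity I γ v e) : ContinuousAt γ e :=
  h.mdifferentiableAt.continuousAt

theorem mfderiv_one (h : HasVelocity I γ v e) : mfderiv 𝓘(ℝ, ℝ) I γ e (1 : ℝ) = v := by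
  rw [HasMFDerivAt.mfderiv h]
  exact ContinuousLinearMap.toSpanSingleton_apply_one ℝ v

theorem unique (h : HasVelocity I γ v e) (h' : HasVelocity I γ w e) : v = w :=
  h.mfderiv_one.symm.trans h'.mfderiv_one

theorem of_mdifferentiableAt (h : MDifferentiableAt 𝓘(ℝ, ℝ) I γ e) :
    HasVelocity I γ (mfderiv 𝓘(ℝ, ℝ) I γ e (1 : ℝ)) e := by
  refine h.hasMFDerivAt.congr_mfderiv ?_
  apply ContinuousLinearMap.ext_ring
  have h1 (w : E) : w = ContinuousLinearMap.toSpanSingleton ℝ w (1 : ℝ) := by simp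
  exact h1 _

theorem congr (h : HasVelocity I γ v e) (hγ : γ' =ᶠ[𝓝 e] γ) : HasVelocity I γ' v e := by
  unfold HasVelocity at h ⊢
  exact HasMFDerivAt.congr_of_eventuallyEq h hγ

theorem const (p : M) (e : ℝ) : HasVelocity I (fun _ => p) 0 e := by
  refine (hasMFDerivAt_const p e).congr_mfderiv ?_
  exact (ContinuousLinearMap.toSpanSingleton_zero ℝ).symm

theorem comp_within {F : M → M'} {S : Set M} {p : M} {L : E →L[ℝ] E'}
    (hF : HasMFDerivWithinAt I I' F S p L) (hγ : HasVelocity I γ v e) (hp : γ e = p)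
    (hS : ∀ᶠ t in 𝓝 e, γ t ∈ S) : HasVelocity I' (fun t => F (γ t)) (L v) e := by
  subst hp
  have h1 : HasMFDerivWithinAt 𝓘(ℝ, ℝ) I' (F ∘ γ) (γ ⁻¹' S) e
      (L.comp (ContinuousLinearMap.toSpanSingleton ℝ v)) :=
    HasMFDerivWithinAt.comp e hF (HasMFDerivAt.hasMFDerivWithinAt hγ) subset_rfl
  have h2 := h1.hasMFDerivAt hS
  refine h2.congr_mfderiv ?_
  exact ContinuousLinearMap.comp_toSpanSingleton L v

theorem comp {F : M → M'} {p : M} {L : E →L[ℝ] E'}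
    (hF : HasMFDerivAt I I' F p L) (hγ : HasVelocity I γ v e) (hp : γ e = p) :
    HasVelocity I' (fun t => F (γ t)) (L v) e :=
  comp_within (hasMFDerivWithinAt_univ.2 hF) hγ hp (Eventually.of_forall fun _ => mem_univ _)

theorem id (e : ℝ) : HasVelocity 𝓘(ℝ, ℝ) (fun t : ℝ => t) (1 : ℝ) e := by
  refine (hasMFDerivAt_id e).congr_mfderiv ?_
  apply ContinuousLinearMap.ext_ring
  exact (ContinuousLinearMap.toSpanSingleton_apply_one ℝ (1 : ℝ)).symm

theorem prodMk {δ : ℝ → M'} {u : E'} (hγ : HasVelocity I γ v e) (hδ : HasVelocity I' δ u e) :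
    HasVelocity (I.prod I') (fun t => (γ t, δ t)) ((v, u) : E × E') e := by
  refine (HasMFDerivAt.prodMk hγ hδ).congr_mfderiv ?_
  apply ContinuousLinearMap.ext_ring
  rfl

/-- Two curves with the same position and velocity have images of the same velocity under a
time-dependent map that is differentiable within a set containing both curves. -/
theorem transfer {F : ℝ × M → M'} {S : Set (ℝ × M)} {p : M}
    (hF : MDifferentiableWithinAt (𝓘(ℝ, ℝ).prod I) I' F S (e, p))
    (hγ : HasVelocity I γ v e) (hγ' : HasVelocity I γ' v e) (hp : γ e = p) (hp' : γ' e = p)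
    (hS : ∀ᶠ t in 𝓝 e, (t, γ t) ∈ S) (hS' : ∀ᶠ t in 𝓝 e, (t, γ' t) ∈ S) {u : E'}
    (hu : HasVelocity I' (fun t => F (t, γ t)) u e) :
    HasVelocity I' (fun t => F (t, γ' t)) u e := by
  obtain ⟨L, hL⟩ := exists_hasMFDerivWithinAt hF
  have h1 := comp_within hL ((HasVelocity.id e).prodMk hγ) (by rw [hp]) hS
  have h2 := comp_within hL ((HasVelocity.id e).prodMk hγ') (by rw [hp']) hS'
  rwa [hu.unique h1]

theorem hasDerivAt {c : ℝ → E} (h : HasVelocity 𝓘(ℝ, E) c v e) : HasDerivAt c v e := by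
  have h1 : HasFDerivAt c (ContinuousLinearMap.toSpanSingleton ℝ v) e :=
    hasMFDerivAt_iff_hasFDerivAt.1 h
  exact h1.hasDerivAt.congr_deriv (ContinuousLinearMap.toSpanSingleton_apply_one ℝ v)

theorem of_hasDerivAt {c : ℝ → E} (h : HasDerivAt c v e) : HasVelocity 𝓘(ℝ, E) c v e :=
  hasMFDerivAt_iff_hasFDerivAt.2 h.hasFDerivAt

end HasVelocity

theorem eventually_eq_of_hasVelocity_zero [IsManifold I 1 M] {γ : ℝ → M} {e : ℝ}
    (h : ∀ᶠ t in 𝓝 e, HasVelocity I γ 0 t) : ∀ᶠ t in 𝓝 e, γ t = γ e := by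
  have hc : ∀ᶠ t in 𝓝 e, γ t ∈ (chartAt H (γ e)).source :=
    h.self_of_nhds.continuousAt.eventually_mem (chart_source_mem_nhds H (γ e))
  obtain ⟨r, hr, hball⟩ := Metric.eventually_nhds_iff_ball.1 (h.and hc)
  have hd : ∀ t ∈ Metric.ball e r, HasDerivAt (fun t => extChartAt I (γ e) (γ t)) 0 t := by
    intro t ht
    have h1 := (mdifferentiableAt_extChartAt (I := I) (hball t ht).2).hasMFDerivAt
    have h2 := HasVelocity.comp h1 (hball t ht).1 rfl
    refine h2.hasDerivAt.congr_deriv (map_zero _)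
  filter_upwards [Metric.ball_mem_nhds e hr] with t ht
  have h3 := Metric.isOpen_ball.is_const_of_deriv_eq_zero (convex_ball e r).isPreconnected
    (fun s hs => (hd s hs).differentiableAt.differentiableWithinAt) (fun s hs => (hd s hs).deriv)
    ht (Metric.mem_ball_self hr)
  refine (extChartAt I (γ e)).injOn ?_ ?_ h3
  · rw [extChartAt_source]; exact (hball t ht).2
  · rw [extChartAt_source]; exact mem_chart_source H (γ e)

/-- Local constancy, seen in a chart, passes to the connected set `K`. No limits have to be unique
in `M`. -/
theorem eq_of_hasVelocity_zero [IsManifold I 1 M] {γ : ℝ → M} {K : Set ℝ} (hK : IsOpen K)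
    (hKc : IsPreconnected K) (h : ∀ t ∈ K, HasVelocity I γ 0 t) {t t' : ℝ} (ht : t ∈ K)
    (ht' : t' ∈ K) : γ t = γ t' := by
  have := isPreconnected_iff_preconnectedSpace.1 hKc
  have hloc : IsLocallyConstant (fun t : K => γ t) := by
    rw [IsLocallyConstant.iff_eventually_eq]
    intro t
    have h1 := eventually_eq_of_hasVelocity_zero (I := I) (γ := γ) (e := t)
      (by filter_upwards [hK.mem_nhds t.2] with s hs using h s hs)
    exact continuous_subtype_val.continuousAt.eventually h1
  exact hloc.apply_eq_of_preconnectedSpace ⟨t, ht⟩ ⟨t', ht'⟩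

end Velocity

/-! ### Cancellation rules in a groupoid. -/

section GroupoidAlgebra

namespace LieGroupoid

variable {EG EM G M : Type*}
  [NormedAddCommGroup EG] [NormedSpace ℝ EG] [NormedAddCommGroup EM] [NormedSpace ℝ EM]
  [TopologicalSpace G] [ChartedSpace EG G] [TopologicalSpace M] [ChartedSpace EM M]
  (𝓖 : LieGroupoid EG EM G M)

theorem inv_unit (x : M) : 𝓖.inv (𝓖.unit x) = 𝓖.unit x := by
  have h1 := 𝓖.inv_mul (𝓖.unit x)
  have h2 := 𝓖.mul_unit (𝓖.inv (𝓖.unit x))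
  rw [𝓖.source_inv, 𝓖.target_unit] at h2
  rw [h2, 𝓖.source_unit] at h1
  exact h1

theorem unit_mul' {x : M} {g : G} (h : 𝓖.target g = x) : 𝓖.mul (𝓖.unit x) g = g := by
  subst h; exact 𝓖.unit_mul g

theorem mul_unit' {x : M} {g : G} (h : 𝓖.source g = x) : 𝓖.mul g (𝓖.unit x) = g := by
  subst h; exact 𝓖.mul_unit g

theorem inv_mul_cancel_left {g h : G} (hgh : 𝓖.source g = 𝓖.target h) :
    𝓖.mul (𝓖.inv g) (𝓖.mul g h) = h := by
  rw [← 𝓖.mul_assoc _ _ _ (𝓖.source_inv g) hgh, 𝓖.inv_mul, 𝓖.unit_mul' hgh.symm]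

theorem mul_inv_cancel_left {g h : G} (hgh : 𝓖.target g = 𝓖.target h) :
    𝓖.mul g (𝓖.mul (𝓖.inv g) h) = h := by
  rw [← 𝓖.mul_assoc _ _ _ (𝓖.target_inv g).symm ((𝓖.source_inv g).trans hgh), 𝓖.mul_inv,
    𝓖.unit_mul' hgh.symm]

theorem mul_inv_cancel_right {g h : G} (hgh : 𝓖.source g = 𝓖.target h) :
    𝓖.mul (𝓖.mul g h) (𝓖.inv h) = g := by
  rw [𝓖.mul_assoc _ _ _ hgh (𝓖.target_inv h).symm, 𝓖.mul_inv, 𝓖.mul_unit' hgh]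

theorem inv_mul_cancel_right {g h : G} (hgh : 𝓖.source g = 𝓖.source h) :
    𝓖.mul (𝓖.mul g (𝓖.inv h)) h = g := by
  rw [𝓖.mul_assoc _ _ _ (hgh.trans (𝓖.target_inv h).symm) (𝓖.source_inv h), 𝓖.inv_mul,
    𝓖.mul_unit' hgh]

theorem inv_eq_of_mul_eq_unit {g h : G} (hgh : 𝓖.source g = 𝓖.target h)
    (h1 : 𝓖.mul g h = 𝓖.unit (𝓖.target g)) : h = 𝓖.inv g := by
  have h2 := 𝓖.inv_mul_cancel_left hgh
  rw [h1, 𝓖.mul_unit' (𝓖.source_inv g)] at h2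
  exact h2.symm

theorem inv_inv (g : G) : 𝓖.inv (𝓖.inv g) = g :=
  (𝓖.inv_eq_of_mul_eq_unit (𝓖.source_inv g) (by rw [𝓖.inv_mul, 𝓖.target_inv])).symm

theorem inv_mul_rev {g h : G} (hgh : 𝓖.source g = 𝓖.target h) :
    𝓖.inv (𝓖.mul g h) = 𝓖.mul (𝓖.inv h) (𝓖.inv g) := by
  have hc : 𝓖.source (𝓖.inv h) = 𝓖.target (𝓖.inv g) := by
    rw [𝓖.source_inv, 𝓖.target_inv, hgh]
  refine (𝓖.inv_eq_of_mul_eq_unit ?_ ?_).symm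
  · rw [𝓖.source_mul _ _ hgh, 𝓖.target_mul _ _ hc, 𝓖.target_inv]
  · have h3 : 𝓖.source (𝓖.mul g h) = 𝓖.target (𝓖.inv h) := by
      rw [𝓖.source_mul _ _ hgh, 𝓖.target_inv]
    rw [← 𝓖.mul_assoc _ _ _ h3 hc, 𝓖.mul_inv_cancel_right hgh, 𝓖.mul_inv, 𝓖.target_mul _ _ hgh]

end LieGroupoid

end GroupoidAlgebra

/-! ### Differentiation of products in a Lie groupoid. -/

section Differentiability

open Set Filter Topology

namespace LieGroupoid

variable {EG EM G M : Type*}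
  [NormedAddCommGroup EG] [NormedSpace ℝ EG] [NormedAddCommGroup EM] [NormedSpace ℝ EM]
  [TopologicalSpace G] [ChartedSpace EG G] [TopologicalSpace M] [ChartedSpace EM M]
  (𝓖 : LieGroupoid EG EM G M)
  {E H X : Type*} [NormedAddCommGroup E] [NormedSpace ℝ E] [TopologicalSpace H]
  {I : ModelWithCorners ℝ E H} [TopologicalSpace X] [ChartedSpace H X]

theorem contMDiff_source : ContMDiff 𝓘(ℝ, EG) 𝓘(ℝ, EM) ∞ 𝓖.source :=
  𝓖.isSubmersion_source.contMDiff

theorem contMDiff_target : ContMDiff 𝓘(ℝ, EG) 𝓘(ℝ, EM) ∞ 𝓖.target :=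
  𝓖.isSubmersion_target.contMDiff

theorem contMDiffOn_mul_comp {A B : X → G} {S : Set X} (hA : ContMDiffOn I 𝓘(ℝ, EG) ∞ A S)
    (hB : ContMDiffOn I 𝓘(ℝ, EG) ∞ B S) (hAB : ∀ q ∈ S, 𝓖.source (A q) = 𝓖.target (B q)) :
    ContMDiffOn I 𝓘(ℝ, EG) ∞ (fun q => 𝓖.mul (A q) (B q)) S :=
  𝓖.contMDiffOn_mul.comp (hA.prodMk hB) hAB

theorem contMDiffOn_inv_comp {A : X → G} {S : Set X} (hA : ContMDiffOn I 𝓘(ℝ, EG) ∞ A S) :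
    ContMDiffOn I 𝓘(ℝ, EG) ∞ (fun q => 𝓖.inv (A q)) S :=
  𝓖.contMDiff_inv.comp_contMDiffOn hA

theorem mdifferentiableWithinAt_mul_comp {A B : X → G} {S : Set X} {p : X}
    (hA : MDifferentiableWithinAt I 𝓘(ℝ, EG) A S p) (hB : MDifferentiableWithinAt I 𝓘(ℝ, EG) B S p)
    (hp : p ∈ S) (hAB : ∀ q ∈ S, 𝓖.source (A q) = 𝓖.target (B q)) :
    MDifferentiableWithinAt I 𝓘(ℝ, EG) (fun q => 𝓖.mul (A q) (B q)) S p :=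
  MDifferentiableWithinAt.comp p (u := {p : G × G | 𝓖.source p.1 = 𝓖.target p.2})
    ((𝓖.contMDiffOn_mul (A p, B p) (hAB p hp)).mdifferentiableWithinAt (by simp))
    (hA.prodMk hB) hAB

theorem mdifferentiableWithinAt_inv_comp {A : X → G} {S : Set X} {p : X}
    (hA : MDifferentiableWithinAt I 𝓘(ℝ, EG) A S p) :
    MDifferentiableWithinAt I 𝓘(ℝ, EG) (fun q => 𝓖.inv (A q)) S p :=
  MDifferentiableAt.comp_mdifferentiableWithinAt p
    (𝓖.contMDiff_inv.mdifferentiableAt (by simp)) hA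

variable {𝓖} {g : G} {x y : M} {a b c γ : ℝ → G} {v w α β : EG} {e : ℝ}

theorem hasVelocity_rightTranslation (hc : HasVelocity 𝓘(ℝ, EG) c v e) (hc0 : c e = 𝓖.unit x)
    (hs : ∀ᶠ t in 𝓝 e, 𝓖.source (c t) = x) (hg : 𝓖.target g = x) :
    HasVelocity 𝓘(ℝ, EG) (fun t => 𝓖.mul (c t) g) (𝓖.rightTranslation x g v) e := by
  let L : EG →L[ℝ] EG := mfderivWithin 𝓘(ℝ, EG) 𝓘(ℝ, EG) (fun k => 𝓖.mul k g)
    {k | 𝓖.source k = x} (𝓖.unit x)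
  have hL : HasMFDerivWithinAt 𝓘(ℝ, EG) 𝓘(ℝ, EG) (fun k => 𝓖.mul k g)
      {k | 𝓖.source k = x} (𝓖.unit x) L :=
    (𝓖.mdifferentiableWithinAt_mul_comp mdifferentiableWithinAt_id
      mdifferentiableWithinAt_const (𝓖.source_unit x)
      fun k hk => (show 𝓖.source k = x from hk).trans hg.symm).hasMFDerivWithinAt
  have h := HasVelocity.comp_within hL hc hc0 hs
  exact h

theorem hasVelocity_leftTranslation (hc : HasVelocity 𝓘(ℝ, EG) c v e) (hc0 : c e = 𝓖.unit x)
    (ht : ∀ᶠ t in 𝓝 e, 𝓖.target (c t) = x) (hg : 𝓖.source g = x) :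
    HasVelocity 𝓘(ℝ, EG) (fun t => 𝓖.mul g (c t)) (𝓖.leftTranslation x g v) e := by
  let L : EG →L[ℝ] EG := mfderivWithin 𝓘(ℝ, EG) 𝓘(ℝ, EG) (fun k => 𝓖.mul g k)
    {k | 𝓖.target k = x} (𝓖.unit x)
  have hL : HasMFDerivWithinAt 𝓘(ℝ, EG) 𝓘(ℝ, EG) (fun k => 𝓖.mul g k)
      {k | 𝓖.target k = x} (𝓖.unit x) L :=
    (𝓖.mdifferentiableWithinAt_mul_comp mdifferentiableWithinAt_const
      mdifferentiableWithinAt_id (𝓖.target_unit x)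
      fun k hk => hg.trans (show 𝓖.target k = x from hk).symm).hasMFDerivWithinAt
  have h := HasVelocity.comp_within hL hc hc0 ht
  exact h

theorem hasVelocity_inv (hc : HasVelocity 𝓘(ℝ, EG) c v e) (hc0 : c e = 𝓖.unit x) :
    HasVelocity 𝓘(ℝ, EG) (fun t => 𝓖.inv (c t)) (𝓖.invDifferential x v) e := by
  let L : EG →L[ℝ] EG := mfderiv 𝓘(ℝ, EG) 𝓘(ℝ, EG) 𝓖.inv (𝓖.unit x)
  have hL : HasMFDerivAt 𝓘(ℝ, EG) 𝓘(ℝ, EG) 𝓖.inv (𝓖.unit x) L :=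
    (𝓖.contMDiff_inv.mdifferentiableAt (by simp)).hasMFDerivAt
  have h := HasVelocity.comp hL hc hc0
  exact h

/-- The vector `r_g α + l_g (di β)` at the arrow `g : y → x`, for `α` and `β` in the Lie algebroid
over `x` and `y`. -/
noncomputable def infinitesimalAction (𝓖 : LieGroupoid EG EM G M) (x y : M) (g : G) (α β : EG) :
    EG :=
  (𝓖.rightTranslation x g α + 𝓖.leftTranslation y g (𝓖.invDifferential y β) :
    TangentSpace 𝓘(ℝ, EG) g)

/-- The velocity of `t ↦ a(t) g b(t)⁻¹` for curves `a`, `b` in source fibres that pass through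
units. -/
theorem hasVelocity_mul_mul_inv (ha : HasVelocity 𝓘(ℝ, EG) a α e)
    (hb : HasVelocity 𝓘(ℝ, EG) b β e) (ha0 : a e = 𝓖.unit x) (hb0 : b e = 𝓖.unit y)
    (has : ∀ᶠ t in 𝓝 e, 𝓖.source (a t) = x) (hbs : ∀ᶠ t in 𝓝 e, 𝓖.source (b t) = y)
    (hx : 𝓖.target g = x) (hy : 𝓖.source g = y) :
    HasVelocity 𝓘(ℝ, EG) (fun t => 𝓖.mul (𝓖.mul (a t) g) (𝓖.inv (b t)))
      (𝓖.infinitesimalAction x y g α β) e := by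
  -- The two occurrences of time are made independent. The derivative along the diagonal is then the
  -- sum of the two partial ones, all taken within the pairs where the product is defined.
  let S : Set (ℝ × ℝ) := {q | 𝓖.source (a q.1) = x ∧ 𝓖.source (b q.2) = y}
  have hS : (e, e) ∈ S := ⟨has.self_of_nhds, hbs.self_of_nhds⟩
  have hQ : MDifferentiableWithinAt (𝓘(ℝ, ℝ).prod 𝓘(ℝ, ℝ)) 𝓘(ℝ, EG)
      (fun q : ℝ × ℝ => 𝓖.mul (𝓖.mul (a q.1) g) (𝓖.inv (b q.2))) S (e, e) := by
    refine 𝓖.mdifferentiableWithinAt_mul_comp (𝓖.mdifferentiableWithinAt_mul_comp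
      (MDifferentiableAt.comp_mdifferentiableWithinAt (e, e) ha.mdifferentiableAt
        mdifferentiableWithinAt_fst) mdifferentiableWithinAt_const hS
      fun q hq => hq.1.trans hx.symm) (𝓖.mdifferentiableWithinAt_inv_comp
      (MDifferentiableAt.comp_mdifferentiableWithinAt (e, e) hb.mdifferentiableAt
        mdifferentiableWithinAt_snd)) hS fun q hq => ?_
    rw [𝓖.source_mul _ _ (hq.1.trans hx.symm), 𝓖.target_inv, hq.2, hy]
  obtain ⟨L, hL⟩ := exists_hasMFDerivWithinAt hQ
  have h1 := HasVelocity.comp_within hL ((HasVelocity.id e).prodMk (HasVelocity.id e)) rfl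
    (has.and hbs)
  have h2 := HasVelocity.comp_within hL ((HasVelocity.id e).prodMk (HasVelocity.const e e)) rfl
    (has.mono fun t ht => ⟨ht, hbs.self_of_nhds⟩)
  have h3 := HasVelocity.comp_within hL ((HasVelocity.const e e).prodMk (HasVelocity.id e)) rfl
    (hbs.mono fun t ht => ⟨has.self_of_nhds, ht⟩)
  have h2' : HasVelocity 𝓘(ℝ, EG) (fun t => 𝓖.mul (a t) g) (L (1, 0)) e := by
    refine h2.congr (has.mono fun t ht => ?_)
    change _ = 𝓖.mul (𝓖.mul (a t) g) (𝓖.inv (b e))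
    rw [hb0, 𝓖.inv_unit, 𝓖.mul_unit']
    rw [𝓖.source_mul _ _ (ht.trans hx.symm), hy]
  have h3' : HasVelocity 𝓘(ℝ, EG) (fun t => 𝓖.mul g (𝓖.inv (b t))) (L (0, 1)) e := by
    refine h3.congr (hbs.mono fun t ht => ?_)
    change _ = 𝓖.mul (𝓖.mul (a e) g) (𝓖.inv (b t))
    rw [ha0, 𝓖.unit_mul' hx]
  have h4 := h2'.unique (hasVelocity_rightTranslation ha ha0 has hx)
  have h5 := h3'.unique (hasVelocity_leftTranslation (hasVelocity_inv hb hb0)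
    (by rw [hb0, 𝓖.inv_unit]) (hbs.mono fun t ht => by rw [𝓖.target_inv, ht]) hy)
  have h6 : L (1, 1) = 𝓖.infinitesimalAction x y g α β := by
    have : ((1, 1) : ℝ × ℝ) = (1, 0) + (0, 1) := by simp
    rw [this, map_add, h4, h5]
    rfl
  rw [← h6]
  exact h1

/-- The curve `a g b⁻¹` has the same position and velocity as `γ` at `e`, so `γ` may be replaced by
it. Then `a⁻¹ (a g b⁻¹) b = g` is constant. -/
theorem hasVelocity_inv_mul_mul_zero (ha : HasVelocity 𝓘(ℝ, EG) a α e)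
    (hb : HasVelocity 𝓘(ℝ, EG) b β e) (ha0 : a e = 𝓖.unit x) (hb0 : b e = 𝓖.unit y)
    (has : ∀ᶠ t in 𝓝 e, 𝓖.source (a t) = x) (hbs : ∀ᶠ t in 𝓝 e, 𝓖.source (b t) = y)
    (hγ0 : γ e = g) (hγt : ∀ᶠ t in 𝓝 e, 𝓖.target (γ t) = 𝓖.target (a t))
    (hγs : ∀ᶠ t in 𝓝 e, 𝓖.source (γ t) = 𝓖.target (b t))
    (hγ : HasVelocity 𝓘(ℝ, EG) γ (𝓖.infinitesimalAction x y g α β) e) :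
    HasVelocity 𝓘(ℝ, EG) (fun t => 𝓖.mul (𝓖.mul (𝓖.inv (a t)) (γ t)) (b t)) 0 e := by
  have hx : 𝓖.target g = x := by rw [← hγ0, hγt.self_of_nhds, ha0, 𝓖.target_unit]
  have hy : 𝓖.source g = y := by rw [← hγ0, hγs.self_of_nhds, hb0, 𝓖.target_unit]
  let S : Set (ℝ × G) := {q | 𝓖.target q.2 = 𝓖.target (a q.1) ∧ 𝓖.source q.2 = 𝓖.target (b q.1)}
  have hS : (e, g) ∈ S := by
    constructor
    · change 𝓖.target g = 𝓖.target (a e); rw [hx, ha0, 𝓖.target_unit]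
    · change 𝓖.source g = 𝓖.target (b e); rw [hy, hb0, 𝓖.target_unit]
  have hF : MDifferentiableWithinAt (𝓘(ℝ, ℝ).prod 𝓘(ℝ, EG)) 𝓘(ℝ, EG)
      (fun q : ℝ × G => 𝓖.mul (𝓖.mul (𝓖.inv (a q.1)) q.2) (b q.1)) S (e, g) := by
    refine 𝓖.mdifferentiableWithinAt_mul_comp (𝓖.mdifferentiableWithinAt_mul_comp
      (𝓖.mdifferentiableWithinAt_inv_comp (MDifferentiableAt.comp_mdifferentiableWithinAt (e, g)
        ha.mdifferentiableAt mdifferentiableWithinAt_fst)) mdifferentiableWithinAt_snd hS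
      fun q hq => (𝓖.source_inv _).trans hq.1.symm) (MDifferentiableAt.comp_mdifferentiableWithinAt
        (e, g) hb.mdifferentiableAt mdifferentiableWithinAt_fst) hS fun q hq => ?_
    rw [𝓖.source_mul _ _ ((𝓖.source_inv _).trans hq.1.symm), hq.2]
  have hq := hasVelocity_mul_mul_inv ha hb ha0 hb0 has hbs hx hy
  refine HasVelocity.transfer hF hq hγ ?_ hγ0 ?_ (hγt.and hγs) ?_
  · rw [ha0, hb0, 𝓖.inv_unit, 𝓖.unit_mul' hx, 𝓖.mul_unit' hy]
  · filter_upwards [has, hbs] with t h1 h2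
    have h3 : 𝓖.source (a t) = 𝓖.target g := h1.trans hx.symm
    have h4 : 𝓖.source (𝓖.mul (a t) g) = 𝓖.target (𝓖.inv (b t)) := by
      rw [𝓖.source_mul _ _ h3, 𝓖.target_inv, h2, hy]
    constructor
    · change 𝓖.target (𝓖.mul (𝓖.mul (a t) g) (𝓖.inv (b t))) = 𝓖.target (a t)
      rw [𝓖.target_mul _ _ h4, 𝓖.target_mul _ _ h3]
    · change 𝓖.source (𝓖.mul (𝓖.mul (a t) g) (𝓖.inv (b t))) = 𝓖.target (b t)
      rw [𝓖.source_mul _ _ h4, 𝓖.source_inv]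
  · refine (HasVelocity.const g e).congr ?_
    filter_upwards [has, hbs] with t h1 h2
    have h3 : 𝓖.source (a t) = 𝓖.target g := h1.trans hx.symm
    have h4 : 𝓖.source (𝓖.mul (a t) g) = 𝓖.source (b t) := by rw [𝓖.source_mul _ _ h3, h2, hy]
    have h5 : 𝓖.source (𝓖.mul (a t) g) = 𝓖.target (𝓖.inv (b t)) := by rw [h4, 𝓖.target_inv]
    change 𝓖.mul (𝓖.mul (𝓖.inv (a t)) (𝓖.mul (𝓖.mul (a t) g) (𝓖.inv (b t)))) (b t) = g
    rw [𝓖.mul_assoc _ _ _ h3 (by rw [𝓖.target_inv, h2, hy]), 𝓖.inv_mul_cancel_left,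
      𝓖.inv_mul_cancel_right (hy.trans h2.symm)]
    rw [𝓖.target_mul _ _ (by rw [𝓖.target_inv, h2, hy]), h3]

end LieGroupoid

end Differentiability

/-! ### Right logarithmic derivatives and uniqueness. -/

section LogVelocity

open Set Filter Topology

namespace LieGroupoid

variable {EG EM G M : Type*}
  [NormedAddCommGroup EG] [NormedSpace ℝ EG] [NormedAddCommGroup EM] [NormedSpace ℝ EM]
  [TopologicalSpace G] [ChartedSpace EG G] [TopologicalSpace M] [ChartedSpace EM M]

/-- The curve `τ` has the right logarithmic derivative `v` at the time `e`: the curve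
`t ↦ τ(t) τ(e)⁻¹` has the velocity `v` at `e`. -/
def HasLogVelocity (𝓖 : LieGroupoid EG EM G M) (τ : ℝ → G) (v : EG) (e : ℝ) : Prop :=
  HasVelocity 𝓘(ℝ, EG) (fun t => 𝓖.mul (τ t) (𝓖.inv (τ e))) v e

variable {𝓖 : LieGroupoid EG EM G M} {x y : M} {τ τ' σ γ : ℝ → G} {v : EG} {e : ℝ} {K : Set ℝ}

theorem HasLogVelocity.congr (h : 𝓖.HasLogVelocity τ v e) (hτ : τ' =ᶠ[𝓝 e] τ) :
    𝓖.HasLogVelocity τ' v e := by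
  refine HasVelocity.congr h ?_
  filter_upwards [hτ] with t ht
  rw [ht, hτ.self_of_nhds]

/-- The factor `g` cancels in `(τ(t) g)(τ(e) g)⁻¹`. This right invariance lets local solutions be
moved to any prescribed initial arrow. -/
theorem HasLogVelocity.mul_right (h : 𝓖.HasLogVelocity τ v e) {g : G}
    (hs : ∀ᶠ t in 𝓝 e, 𝓖.source (τ t) = 𝓖.target g) :
    𝓖.HasLogVelocity (fun t => 𝓖.mul (τ t) g) v e := by
  refine HasVelocity.congr h ?_
  filter_upwards [hs] with t ht
  have he := hs.self_of_nhds
  rw [𝓖.inv_mul_rev he, ← 𝓖.mul_assoc, 𝓖.mul_inv_cancel_right ht]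
  · rw [𝓖.source_mul _ _ ht, 𝓖.target_inv]
  · rw [𝓖.source_inv, 𝓖.target_inv, he]

/-- Around each time `e`, replace `τ` and `σ` by `τ τ(e)⁻¹` and `σ σ(e)⁻¹`, which pass through
units. The previous computation gives zero velocity, and multiplication by the fixed arrows `τ(e)⁻¹`
and `σ(e)` recovers the original product. -/
theorem eq_of_hasLogVelocity [IsManifold 𝓘(ℝ, EG) ∞ G] (hK : IsOpen K) (hKc : IsPreconnected K)
    {α β : ℝ → EG} (hτs : ∀ t ∈ K, 𝓖.source (τ t) = x) (hσs : ∀ t ∈ K, 𝓖.source (σ t) = y)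
    (hτ : ∀ t ∈ K, 𝓖.HasLogVelocity τ (α t) t) (hσ : ∀ t ∈ K, 𝓖.HasLogVelocity σ (β t) t)
    (hγt : ∀ t ∈ K, 𝓖.target (γ t) = 𝓖.target (τ t))
    (hγs : ∀ t ∈ K, 𝓖.source (γ t) = 𝓖.target (σ t))
    (hγ : ∀ t ∈ K, HasVelocity 𝓘(ℝ, EG) γ
      (𝓖.infinitesimalAction (𝓖.target (τ t)) (𝓖.target (σ t)) (γ t) (α t) (β t)) t)
    {t t' : ℝ} (ht : t ∈ K) (ht' : t' ∈ K) :
    𝓖.mul (𝓖.mul (𝓖.inv (τ t)) (γ t)) (σ t) = 𝓖.mul (𝓖.mul (𝓖.inv (τ t')) (γ t')) (σ t') := by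
  refine eq_of_hasVelocity_zero (I := 𝓘(ℝ, EG))
    (γ := fun t => 𝓖.mul (𝓖.mul (𝓖.inv (τ t)) (γ t)) (σ t)) hK hKc (fun e he => ?_) ht ht'
  have hKe : ∀ᶠ t in 𝓝 e, t ∈ K := hK.mem_nhds he
  have hτc : ∀ t ∈ K, 𝓖.source (τ t) = 𝓖.target (𝓖.inv (τ e)) := fun t ht => by
    rw [𝓖.target_inv, hτs t ht, hτs e he]
  have hσc : ∀ t ∈ K, 𝓖.source (σ t) = 𝓖.target (𝓖.inv (σ e)) := fun t ht => by
    rw [𝓖.target_inv, hσs t ht, hσs e he]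
  have h0 := hasVelocity_inv_mul_mul_zero (hτ e he) (hσ e he) (𝓖.mul_inv _) (𝓖.mul_inv _)
    (hKe.mono fun t ht => by rw [𝓖.source_mul _ _ (hτc t ht), 𝓖.source_inv])
    (hKe.mono fun t ht => by rw [𝓖.source_mul _ _ (hσc t ht), 𝓖.source_inv])
    rfl (hKe.mono fun t ht => by rw [𝓖.target_mul _ _ (hτc t ht), hγt t ht])
    (hKe.mono fun t ht => by rw [𝓖.target_mul _ _ (hσc t ht), hγs t ht]) (hγ e he)
  let S : Set G := {k | 𝓖.target k = 𝓖.target (τ e) ∧ 𝓖.source k = 𝓖.target (σ e)}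
  have hmem : ∀ t ∈ K, 𝓖.mul (𝓖.mul (𝓖.inv (𝓖.mul (τ t) (𝓖.inv (τ e)))) (γ t))
      (𝓖.mul (σ t) (𝓖.inv (σ e))) ∈ S := by
    intro t ht
    have h1 : 𝓖.source (𝓖.inv (𝓖.mul (τ t) (𝓖.inv (τ e)))) = 𝓖.target (γ t) := by
      rw [𝓖.source_inv, 𝓖.target_mul _ _ (hτc t ht), hγt t ht]
    have h2 : 𝓖.source (𝓖.mul (𝓖.inv (𝓖.mul (τ t) (𝓖.inv (τ e)))) (γ t)) =
        𝓖.target (𝓖.mul (σ t) (𝓖.inv (σ e))) := by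
      rw [𝓖.source_mul _ _ h1, 𝓖.target_mul _ _ (hσc t ht), hγs t ht]
    constructor
    · rw [𝓖.target_mul _ _ h2, 𝓖.target_mul _ _ h1, 𝓖.target_inv, 𝓖.source_mul _ _ (hτc t ht),
        𝓖.source_inv]
    · rw [𝓖.source_mul _ _ h2, 𝓖.source_mul _ _ (hσc t ht), 𝓖.source_inv]
  have hF : MDifferentiableWithinAt 𝓘(ℝ, EG) 𝓘(ℝ, EG)
      (fun k => 𝓖.mul (𝓖.mul (𝓖.inv (τ e)) k) (σ e)) S
      (𝓖.mul (𝓖.mul (𝓖.inv (𝓖.mul (τ e) (𝓖.inv (τ e)))) (γ e)) (𝓖.mul (σ e) (𝓖.inv (σ e)))) := by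
    refine 𝓖.mdifferentiableWithinAt_mul_comp (𝓖.mdifferentiableWithinAt_mul_comp
      mdifferentiableWithinAt_const mdifferentiableWithinAt_id (hmem e he)
      fun k hk => (𝓖.source_inv _).trans hk.1.symm) mdifferentiableWithinAt_const (hmem e he)
      fun k hk => ?_
    rw [𝓖.source_mul _ _ ((𝓖.source_inv _).trans hk.1.symm)]
    exact hk.2
  obtain ⟨L, hL⟩ := exists_hasMFDerivWithinAt hF
  have h1 := HasVelocity.comp_within hL h0 rfl (hKe.mono hmem)
  rw [map_zero] at h1
  refine h1.congr (hKe.mono fun t ht => ?_)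
  have hc1 : 𝓖.source (𝓖.inv (τ t)) = 𝓖.target (γ t) := by rw [𝓖.source_inv, hγt t ht]
  have hc2 : 𝓖.source (𝓖.inv (𝓖.inv (τ e))) = 𝓖.target (𝓖.inv (τ t)) := by
    rw [𝓖.inv_inv, 𝓖.target_inv, hτs e he, hτs t ht]
  have hc3 : 𝓖.source (𝓖.mul (𝓖.inv (τ t)) (γ t)) = 𝓖.target (σ t) := by
    rw [𝓖.source_mul _ _ hc1, hγs t ht]
  have hc4 : 𝓖.target (𝓖.mul (𝓖.inv (τ t)) (γ t)) = 𝓖.source (τ e) := by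
    rw [𝓖.target_mul _ _ hc1, 𝓖.target_inv, hτs e he, hτs t ht]
  have hc5 : 𝓖.source (τ e) = 𝓖.target (𝓖.mul (𝓖.inv (τ t)) (γ t)) := hc4.symm
  change 𝓖.mul (𝓖.mul (𝓖.inv (τ t)) (γ t)) (σ t) =
    𝓖.mul (𝓖.mul (𝓖.inv (τ e)) (𝓖.mul (𝓖.mul (𝓖.inv (𝓖.mul (τ t) (𝓖.inv (τ e)))) (γ t))
      (𝓖.mul (σ t) (𝓖.inv (σ e))))) (σ e)
  have hd : 𝓖.source (𝓖.mul (τ e) (𝓖.mul (𝓖.inv (τ t)) (γ t))) =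
      𝓖.target (𝓖.mul (σ t) (𝓖.inv (σ e))) := by
    rw [𝓖.source_mul _ _ hc5, hc3, 𝓖.target_mul _ _ (hσc t ht)]
  rw [𝓖.inv_mul_rev (hτc t ht), 𝓖.mul_assoc _ _ _ hc2 hc1, 𝓖.inv_inv,
    ← 𝓖.mul_assoc (𝓖.inv (τ e)) _ _ _ hd, 𝓖.inv_mul_cancel_left hc5,
    ← 𝓖.mul_assoc _ _ _ hc3 (hσc t ht), 𝓖.inv_mul_cancel_right]
  · rw [𝓖.source_mul _ _ hc3, hσs t ht, hσs e he]
  · rw [𝓖.source_inv, 𝓖.target_mul _ _ hc5]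

/-- Constancy of `τ⁻¹ γ σ` is used with `γ` the curve of units over the common target. This `γ`
equals `a u a⁻¹` for `a = τ τ(e)⁻¹` and `u` the unit over the target of `τ(e)`, so it has the
required velocity. -/
theorem eqOn_of_hasLogVelocity [IsManifold 𝓘(ℝ, EG) ∞ G] (hK : IsOpen K)
    (hKc : IsPreconnected K) {α : ℝ → EG} (hτs : ∀ t ∈ K, 𝓖.source (τ t) = x)
    (hσs : ∀ t ∈ K, 𝓖.source (σ t) = x) (htar : ∀ t ∈ K, 𝓖.target (σ t) = 𝓖.target (τ t))
    (hτ : ∀ t ∈ K, 𝓖.HasLogVelocity τ (α t) t) (hσ : ∀ t ∈ K, 𝓖.HasLogVelocity σ (α t) t)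
    {e : ℝ} (he : e ∈ K) (heq : τ e = σ e) : EqOn τ σ K := by
  intro t ht
  have hγ : ∀ t ∈ K, HasVelocity 𝓘(ℝ, EG) (fun t => 𝓖.unit (𝓖.target (τ t)))
      (𝓖.infinitesimalAction (𝓖.target (τ t)) (𝓖.target (σ t)) (𝓖.unit (𝓖.target (τ t)))
        (α t) (α t)) t := by
    intro e he
    have hKe : ∀ᶠ t in 𝓝 e, t ∈ K := hK.mem_nhds he
    have hτc : ∀ t ∈ K, 𝓖.source (τ t) = 𝓖.target (𝓖.inv (τ e)) := fun t ht => by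
      rw [𝓖.target_inv, hτs t ht, hτs e he]
    have hs : ∀ t ∈ K, 𝓖.source (𝓖.mul (τ t) (𝓖.inv (τ e))) = 𝓖.target (τ e) := fun t ht => by
      rw [𝓖.source_mul _ _ (hτc t ht), 𝓖.source_inv]
    rw [htar e he]
    refine (hasVelocity_mul_mul_inv (hτ e he) (hτ e he) (𝓖.mul_inv _) (𝓖.mul_inv _)
      (hKe.mono hs) (hKe.mono hs) (𝓖.target_unit _) (𝓖.source_unit _)).congr
      (hKe.mono fun t ht => ?_)
    change 𝓖.unit (𝓖.target (τ t)) = 𝓖.mul (𝓖.mul (𝓖.mul (τ t) (𝓖.inv (τ e)))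
      (𝓖.unit (𝓖.target (τ e)))) (𝓖.inv (𝓖.mul (τ t) (𝓖.inv (τ e))))
    rw [𝓖.mul_unit' (hs t ht), 𝓖.mul_inv, 𝓖.target_mul _ _ (hτc t ht)]
  have h := 𝓖.eq_of_hasLogVelocity hK hKc hτs hσs hτ hσ (fun t _ => 𝓖.target_unit _)
    (fun t ht => by rw [𝓖.source_unit, htar t ht]) hγ ht he
  have hu : ∀ t, 𝓖.mul (𝓖.inv (τ t)) (𝓖.unit (𝓖.target (τ t))) = 𝓖.inv (τ t) := fun t =>
    𝓖.mul_unit' (𝓖.source_inv _)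
  rw [hu, hu, heq, 𝓖.inv_mul, hσs e he] at h
  have h2 := 𝓖.mul_inv_cancel_left (htar t ht).symm
  rw [h, 𝓖.mul_unit' (hτs t ht)] at h2
  exact h2

end LieGroupoid

end LogVelocity

/-! ### Normal form of a submersion and retraction onto its fibres. -/

section Submersion

open Set Filter Topology

/-- Around every point, a submersion `f` becomes linear in suitable charts, and there is a smooth
retraction `ρ` onto its fibres: `ρ (y, ·)` maps to the fibre over `y` and fixes the points of that
fibre. -/
theorem Manifold.IsSubmersion.exists_charts_retraction {EG EM G M : Type*}
    [NormedAddCommGroup EG] [NormedSpace ℝ EG] [NormedAddCommGroup EM] [NormedSpace ℝ EM]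
    [TopologicalSpace G] [ChartedSpace EG G] [TopologicalSpace M] [ChartedSpace EM M]
    [IsManifold 𝓘(ℝ, EG) ∞ G] [IsManifold 𝓘(ℝ, EM) ∞ M] {f : G → M}
    (hf : Manifold.IsSubmersion 𝓘(ℝ, EG) 𝓘(ℝ, EM) ∞ f) (g : G) :
    ∃ (e : OpenPartialHomeomorph G EG) (e' : OpenPartialHomeomorph M EM) (π : EG →L[ℝ] EM)
      (ρ : M × G → G) (O : Set (M × G)), e ∈ IsManifold.maximalAtlas 𝓘(ℝ, EG) ∞ G ∧
      e' ∈ IsManifold.maximalAtlas 𝓘(ℝ, EM) ∞ M ∧ g ∈ e.source ∧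
      (∀ k ∈ e.source, f k ∈ e'.source ∧ e' (f k) = π (e k)) ∧ IsOpen O ∧ (f g, g) ∈ O ∧
      ContMDiffOn (𝓘(ℝ, EM).prod 𝓘(ℝ, EG)) 𝓘(ℝ, EG) ∞ ρ O ∧ (∀ p ∈ O, f (ρ p) = p.1) ∧
      ∀ k, (f k, k) ∈ O → ρ (f k, k) = k := by
  have h := hf.isSubmersionAt g
  let e := h.domChart
  let e' := h.codChart
  have he : e ∈ IsManifold.maximalAtlas 𝓘(ℝ, EG) ∞ G := h.domChart_mem_maximalAtlas
  have he' : e' ∈ IsManifold.maximalAtlas 𝓘(ℝ, EM) ∞ M := h.codChart_mem_maximalAtlas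
  let A := h.equiv
  have hsrc : ∀ k ∈ e.source, f k ∈ e'.source := fun k hk => h.source_subset_preimage_source hk
  have hwr : ∀ z ∈ e.target, e' (f (e.symm z)) = (A z).1 := by
    intro z hz
    have hz' : z ∈ (h.domChart.extend 𝓘(ℝ, EG)).target := by simpa using hz
    simpa using h.writtenInCharts hz'
  have hlin : ∀ k ∈ e.source, e' (f k) = (A (e k)).1 := by
    intro k hk
    have := hwr (e k) (e.map_source hk)
    rwa [e.left_inv hk] at this
  -- In the normal form the base coordinate is overwritten by that of the prescribed point and the
  -- fibre coordinate is kept.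
  let m : M × G → EG := fun p => A.symm (e' p.1, (A (e p.2)).2)
  have hm : ContMDiffOn (𝓘(ℝ, EM).prod 𝓘(ℝ, EG)) 𝓘(ℝ, EG) ∞ m (e'.source ×ˢ e.source) := by
    have h1 : ContMDiffOn (𝓘(ℝ, EM).prod 𝓘(ℝ, EG)) 𝓘(ℝ, EM) ∞ (fun p : M × G => e' p.1)
        (e'.source ×ˢ e.source) :=
      (contMDiffOn_of_mem_maximalAtlas he').comp contMDiffOn_fst fun p hp => hp.1
    have h2 : ContMDiffOn (𝓘(ℝ, EM).prod 𝓘(ℝ, EG)) 𝓘(ℝ, EG) ∞ (fun p : M × G => e p.2)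
        (e'.source ×ˢ e.source) :=
      (contMDiffOn_of_mem_maximalAtlas he).comp contMDiffOn_snd fun p hp => hp.2
    have h3 : ContDiff ℝ ∞ (fun q : EM × EG => A.symm (q.1, (A q.2).2)) :=
      A.symm.contDiff.comp (contDiff_fst.prodMk
        (contDiff_snd.comp (A.contDiff.comp contDiff_snd)))
    exact h3.contMDiff.comp_contMDiffOn (h1.prodMk_space h2)
  refine ⟨e, e', (ContinuousLinearMap.fst ℝ EM h.complement).comp (A : EG →L[ℝ] _),
    fun p => e.symm (m p), (e'.source ×ˢ e.source) ∩ m ⁻¹' e.target, he, he',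
    h.mem_domChart_source, fun k hk => ⟨hsrc k hk, hlin k hk⟩,
    hm.continuousOn.isOpen_inter_preimage (e'.open_source.prod e.open_source) e.open_target,
    ⟨⟨h.mem_codChart_source, h.mem_domChart_source⟩, ?_⟩, ?_, ?_, ?_⟩
  · change A.symm (e' (f g), (A (e g)).2) ∈ e.target
    rw [hlin g h.mem_domChart_source]
    simpa using e.map_source h.mem_domChart_source
  · exact (contMDiffOn_symm_of_mem_maximalAtlas he).comp (hm.mono inter_subset_left)
      fun p hp => hp.2
  · rintro ⟨y, k⟩ ⟨⟨hy, hk⟩, hmt⟩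
    have h1 := hwr _ hmt
    have h2 : (A (m (y, k))).1 = e' y := by simp [m]
    exact e'.injOn (hsrc _ (e.map_target hmt)) hy (h1.trans h2)
  · rintro k ⟨⟨_, hk⟩, _⟩
    change e.symm (A.symm (e' (f k), (A (e k)).2)) = k
    rw [hlin k hk]
    simpa using e.left_inv hk

end Submersion

/-! ### Curves in source fibres with prescribed velocity. -/

section FibreCurve

open Set Filter Topology

theorem exists_hasVelocity {E M : Type*} [NormedAddCommGroup E] [NormedSpace ℝ E]
    [TopologicalSpace M] [ChartedSpace E M] (p : M) (v : E) (e : ℝ) :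
    ∃ γ : ℝ → M, γ e = p ∧ HasVelocity 𝓘(ℝ, E) γ v e := by
  let l : ℝ → E := fun t => chartAt E p p + (t - e) • v
  have hl : HasDerivAt l v e := by
    have := (((hasDerivAt_id e).sub_const e).smul_const v).const_add (chartAt E p p)
    simpa [l] using this
  have hl0 : l e = chartAt E p p := by simp [l]
  have hγ0 : (chartAt E p).symm (l e) = p := by
    rw [hl0, (chartAt E p).left_inv (mem_chart_source E p)]
  have htar : l e ∈ (chartAt E p).target := by
    rw [hl0]; exact (chartAt E p).map_source (mem_chart_source E p)
  refine ⟨fun t => (chartAt E p).symm (l t), hγ0, ?_⟩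
  refine ⟨((chartAt E p).symm.continuousAt htar).comp (f := l) hl.continuousAt, ?_⟩
  have hd : HasFDerivAt l (ContinuousLinearMap.toSpanSingleton ℝ v) e := hl.hasFDerivAt
  have hev : ∀ᶠ t in 𝓝 e, l t ∈ (chartAt E p).target :=
    hl.continuousAt.eventually_mem ((chartAt E p).open_target.mem_nhds htar)
  refine HasFDerivAt.hasFDerivWithinAt ?_
  refine hd.congr_of_eventuallyEq (hev.mono fun t ht => ?_)
  simp only [writtenInExtChartAt, hγ0, mfld_simps]
  exact (chartAt E p).right_inv ht

namespace LieGroupoid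

variable {EG EM G M : Type*}
  [NormedAddCommGroup EG] [NormedSpace ℝ EG] [NormedAddCommGroup EM] [NormedSpace ℝ EM]
  [TopologicalSpace G] [ChartedSpace EG G] [TopologicalSpace M] [ChartedSpace EM M]
  [IsManifold 𝓘(ℝ, EG) ∞ G] [IsManifold 𝓘(ℝ, EM) ∞ M]

/-- Take any curve `γ` with velocity `v` and retract it to `ρ (x, γ)`. Since `ds v = 0`, the curves
`(s ∘ γ, γ)` and `(x, γ)` have the same velocity, and `ρ` maps the former to `γ`. -/
theorem exists_hasVelocity_source_eq (𝓖 : LieGroupoid EG EM G M) {x : M} {v : EG}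
    (hv : v ∈ 𝓖.algebroidFiber x) (e : ℝ) :
    ∃ c : ℝ → G, c e = 𝓖.unit x ∧ (∀ t, 𝓖.source (c t) = x) ∧ HasVelocity 𝓘(ℝ, EG) c v e := by
  obtain ⟨γ, hγ0, hγ⟩ := exists_hasVelocity (𝓖.unit x) v e
  obtain ⟨_, _, _, ρ, O, _, _, _, _, hO, hmem, hρ, hρ1, hρ2⟩ :=
    𝓖.isSubmersion_source.exists_charts_retraction (𝓖.unit x)
  rw [𝓖.source_unit] at hmem
  have hsv : HasVelocity 𝓘(ℝ, EM) (fun t => 𝓖.source (γ t)) (0 : EM) e := by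
    let L : EG →L[ℝ] EM := mfderiv 𝓘(ℝ, EG) 𝓘(ℝ, EM) 𝓖.source (𝓖.unit x)
    have hL : HasMFDerivAt 𝓘(ℝ, EG) 𝓘(ℝ, EM) 𝓖.source (𝓖.unit x) L :=
      (𝓖.contMDiff_source.mdifferentiableAt (by simp)).hasMFDerivAt
    have h1 := HasVelocity.comp hL hγ hγ0
    have h2 : L v = 0 := hv
    rwa [h2] at h1
  have hsx : 𝓖.source (γ e) = x := by rw [hγ0, 𝓖.source_unit]
  obtain ⟨L, hL⟩ := exists_hasMFDerivAt
    ((hρ.contMDiffAt (hO.mem_nhds hmem)).mdifferentiableAt (by simp))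
  have h1 := HasVelocity.comp hL (hsv.prodMk hγ) (by rw [hγ0, 𝓖.source_unit])
  have h2 := HasVelocity.comp hL ((HasVelocity.const x e).prodMk hγ) (by rw [hγ0])
  have hc1 : ContinuousAt (fun t => (𝓖.source (γ t), γ t)) e :=
    hsv.continuousAt.prodMk hγ.continuousAt
  have hc2 : ContinuousAt (fun t => (x, γ t)) e := continuousAt_const.prodMk hγ.continuousAt
  have hO1 : ∀ᶠ t in 𝓝 e, (𝓖.source (γ t), γ t) ∈ O :=
    hc1.eventually_mem (hO.mem_nhds (by rw [hsx, hγ0]; exact hmem))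
  have hO2 : ∀ᶠ t in 𝓝 e, (x, γ t) ∈ O :=
    hc2.eventually_mem (hO.mem_nhds (by rw [hγ0]; exact hmem))
  have h3 : HasVelocity 𝓘(ℝ, EG) γ (L (0, v)) e :=
    h1.congr (hO1.mono fun t ht => (hρ2 _ ht).symm)
  rw [← hγ.unique h3] at h2
  classical
  -- The value at times with `(x, γ t)` outside `O` only has to keep the source equal to `x`.
  refine ⟨fun t => if (x, γ t) ∈ O then ρ (x, γ t) else 𝓖.unit x, ?_, fun t => ?_,
    h2.congr (hO2.mono fun t ht => if_pos ht)⟩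
  · have h4 := hρ2 (𝓖.unit x) (by rwa [𝓖.source_unit])
    rw [𝓖.source_unit] at h4
    simp only [hγ0, if_pos hmem, h4]
  · dsimp only
    split_ifs with ht
    · exact hρ1 _ ht
    · exact 𝓖.source_unit x

end LieGroupoid

end FibreCurve

/-! ### Smoothness of time derivatives as maps into the tangent bundle. -/

section PartialDerivative

open Set Filter Topology

variable {EX HX X E G : Type*} [NormedAddCommGroup EX] [NormedSpace ℝ EX] [TopologicalSpace HX]
  {I : ModelWithCorners ℝ EX HX} [TopologicalSpace X] [ChartedSpace HX X] [IsManifold I ∞ X]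
  [NormedAddCommGroup E] [NormedSpace ℝ E] [TopologicalSpace G] [ChartedSpace E G]
  [IsManifold 𝓘(ℝ, E) ∞ G]

theorem contMDiff_mk_zero_one {f : X → ℝ} (hf : ContMDiff I 𝓘(ℝ, ℝ) ∞ f) :
    ContMDiff I (I.prod 𝓘(ℝ, ℝ)).tangent ∞
      (fun p : X => (⟨(p, f p), ((0, 1) : EX × ℝ)⟩ : TangentBundle (I.prod 𝓘(ℝ, ℝ)) (X × ℝ))) := by
  have h1 : ContMDiff I I.tangent ∞ (fun p : X => (⟨p, (0 : EX)⟩ : TangentBundle I X)) :=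
    Bundle.contMDiff_zeroSection ℝ (TangentSpace I : X → Type _)
  have h2 : ContMDiff I 𝓘(ℝ, ℝ).tangent ∞
      (fun p : X => (⟨f p, (1 : ℝ)⟩ : TangentBundle 𝓘(ℝ, ℝ) ℝ)) := by
    have h3 : ContMDiff 𝓘(ℝ, ℝ) 𝓘(ℝ, ℝ).tangent ∞
        (fun t : ℝ => (⟨t, (1 : ℝ)⟩ : TangentBundle 𝓘(ℝ, ℝ) ℝ)) :=
      contMDiff_vectorSpace_iff_contDiff.2 contDiff_const
    exact h3.comp hf
  exact contMDiff_equivTangentBundleProd_symm.comp (h1.prodMk h2)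

/-- The velocity is the tangent map of `θ` applied to the smooth vector field `(0, 1)` along `p ↦
(p, f p)`. -/
theorem contMDiffOn_partial_velocity {θ : X × ℝ → G} {S : Set (X × ℝ)} (hS : IsOpen S)
    (hθ : ContMDiffOn (I.prod 𝓘(ℝ, ℝ)) 𝓘(ℝ, E) ∞ θ S) {f : X → ℝ}
    (hf : ContMDiff I 𝓘(ℝ, ℝ) ∞ f) {T : Set X} (hT : ∀ p ∈ T, (p, f p) ∈ S) {v : X → E}
    (hv : ∀ p ∈ T, HasVelocity 𝓘(ℝ, E) (fun t => θ (p, t)) (v p) (f p)) :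
    ContMDiffOn I 𝓘(ℝ, E).tangent ∞
      (fun p : X => (⟨θ (p, f p), v p⟩ : TangentBundle 𝓘(ℝ, E) G)) T := by
  have h1 := hθ.contMDiffOn_tangentMapWithin (m := ∞) (by simp) hS.uniqueMDiffOn
  refine (h1.comp (contMDiff_mk_zero_one hf).contMDiffOn hT).congr fun p hp => ?_
  have hd : MDifferentiableAt (I.prod 𝓘(ℝ, ℝ)) 𝓘(ℝ, E) θ (p, f p) :=
    (hθ.contMDiffAt (hS.mem_nhds (hT p hp))).mdifferentiableAt (by simp)
  let L : EX × ℝ →L[ℝ] E := mfderiv (I.prod 𝓘(ℝ, ℝ)) 𝓘(ℝ, E) θ (p, f p)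
  have hL : HasMFDerivAt (I.prod 𝓘(ℝ, ℝ)) 𝓘(ℝ, E) θ (p, f p) L := hd.hasMFDerivAt
  have h2 := HasVelocity.comp hL ((HasVelocity.const (I := I) p (f p)).prodMk
    (HasVelocity.id (f p))) rfl
  have h3 : v p = L (0, 1) := (hv p hp).unique h2
  rw [h3]
  change _ = (⟨θ (p, f p), mfderivWithin (I.prod 𝓘(ℝ, ℝ)) 𝓘(ℝ, E) θ S (p, f p) ((0, 1) : EX × ℝ)⟩ :
    TangentBundle 𝓘(ℝ, E) G)
  rw [mfderivWithin_of_isOpen hS (hT p hp)]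
  rfl

end PartialDerivative

/-! ### Trivial deformations are smoothly exact. -/

section Forward

open Set Filter Topology

variable {EH EN H N EG EM G M : Type*}
  [NormedAddCommGroup EH] [NormedSpace ℝ EH] [NormedAddCommGroup EN] [NormedSpace ℝ EN]
  [NormedAddCommGroup EG] [NormedSpace ℝ EG] [NormedAddCommGroup EM] [NormedSpace ℝ EM]
  [TopologicalSpace H] [ChartedSpace EH H] [TopologicalSpace N] [ChartedSpace EN N]
  [TopologicalSpace G] [ChartedSpace EG G] [TopologicalSpace M] [ChartedSpace EM M]
  {𝓗 : LieGroupoid EH EN H N} {𝓖 : LieGroupoid EG EM G M}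
  {Φ₀ : LieGroupoidHom 𝓗 𝓖} {I : Set ℝ}

namespace MorphismDeformation

variable [IsManifold 𝓘(ℝ, EG) ∞ G] [IsManifold 𝓘(ℝ, EN) ∞ N]

theorem IsTrivialOn.isSmoothlyExactOn {Φ : MorphismDeformation 𝓗 𝓖 Φ₀ I} {J : Set ℝ}
    (hJ : IsOpen J) (hJI : J ⊆ I) (h : Φ.IsTrivialOn J) : Φ.IsSmoothlyExactOn J := by
  obtain ⟨τ, ⟨hτsm, hτs⟩, -, hτΦ⟩ := h
  replace hτs : ∀ x, ∀ ε ∈ J, 𝓖.source (τ (x, ε)) = Φ₀.base x := hτs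
  replace hτΦ : ∀ ε ∈ J, ∀ h, Φ.toFun (h, ε) = 𝓖.mul (𝓖.mul (τ (𝓗.target h, ε)) (Φ₀.toFun h))
    (𝓖.inv (τ (𝓗.source h, ε))) := hτΦ
  have hc1 : ∀ ε ∈ J, ∀ h, 𝓖.source (τ (𝓗.target h, ε)) = 𝓖.target (Φ₀.toFun h) :=
    fun ε hε h => by rw [hτs _ _ hε, Φ₀.isHom.target_map]
  have hc2 : ∀ ε ∈ J, ∀ h, 𝓖.source (Φ₀.toFun h) = 𝓖.source (τ (𝓗.source h, ε)) :=
    fun ε hε h => by rw [hτs _ _ hε, Φ₀.isHom.source_map]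
  have hc3 : ∀ ε ∈ J, ∀ h, 𝓖.source (𝓖.mul (τ (𝓗.target h, ε)) (Φ₀.toFun h)) =
      𝓖.target (𝓖.inv (τ (𝓗.source h, ε))) :=
    fun ε hε h => by rw [𝓖.source_mul _ _ (hc1 ε hε h), 𝓖.target_inv, hc2 ε hε h]
  -- The target of `τ_ε(x)` is read off from the conjugation formula at the unit arrow of `x`.
  have hτt : ∀ x, ∀ ε ∈ J, 𝓖.target (τ (x, ε)) = Φ.base (x, ε) := by
    intro x ε hε
    have h1 := (Φ.isHom ε (hJI hε)).target_map (𝓗.unit x)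
    simp only [hτΦ ε hε] at h1
    rwa [𝓖.target_mul _ _ (hc3 ε hε _), 𝓖.target_mul _ _ (hc1 ε hε _), 𝓗.target_unit] at h1
  -- The second time variable is the one differentiated. Evaluating on the diagonal afterwards gives
  -- `α` smooth in `(x, ε)`.
  let θ : (N × ℝ) × ℝ → G := fun q => 𝓖.mul (τ (q.1.1, q.2)) (𝓖.inv (τ q.1))
  have hθ : ContMDiffOn ((𝓘(ℝ, EN).prod 𝓘(ℝ, ℝ)).prod 𝓘(ℝ, ℝ)) 𝓘(ℝ, EG) ∞ θ
      ((univ ×ˢ J) ×ˢ J) := by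
    refine 𝓖.contMDiffOn_mul_comp (hτsm.comp
      ((contMDiff_fst.comp contMDiff_fst).prodMk contMDiff_snd).contMDiffOn
        fun q hq => ⟨trivial, hq.2⟩)
      (𝓖.contMDiffOn_inv_comp (hτsm.comp contMDiffOn_fst fun q hq => hq.1)) ?_
    rintro ⟨⟨x, ε⟩, e⟩ ⟨⟨_, hε⟩, he⟩
    rw [𝓖.target_inv, hτs _ _ he, hτs _ _ hε]
  let α : N × ℝ → EG := fun p => mfderiv 𝓘(ℝ, ℝ) 𝓘(ℝ, EG) (fun t => θ (p, t)) p.2 (1 : ℝ)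
  have hα : ∀ x, ∀ ε ∈ J, HasVelocity 𝓘(ℝ, EG)
      (fun t => 𝓖.mul (τ (x, t)) (𝓖.inv (τ (x, ε)))) (α (x, ε)) ε := by
    intro x ε hε
    refine HasVelocity.of_mdifferentiableAt (γ := fun t => θ ((x, ε), t)) ?_
    have h1 : ContMDiffOn 𝓘(ℝ, ℝ) 𝓘(ℝ, EG) ∞ (fun t => θ ((x, ε), t)) J :=
      hθ.comp (contMDiff_const.prodMk contMDiff_id).contMDiffOn fun t ht => ⟨⟨trivial, hε⟩, ht⟩
    exact (h1.contMDiffAt (hJ.mem_nhds hε)).mdifferentiableAt (by simp)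
  have hsrc : ∀ x, ∀ ε ∈ J, ∀ t ∈ J,
      𝓖.source (𝓖.mul (τ (x, t)) (𝓖.inv (τ (x, ε)))) = Φ.base (x, ε) := by
    intro x ε hε t ht
    rw [𝓖.source_mul, 𝓖.source_inv, hτt _ _ hε]
    rw [𝓖.target_inv, hτs _ _ hε, hτs _ _ ht]
  have hbase : ∀ x, ∀ ε ∈ J, 𝓖.mul (τ (x, ε)) (𝓖.inv (τ (x, ε))) = 𝓖.unit (Φ.base (x, ε)) := by
    intro x ε hε
    rw [𝓖.mul_inv, hτt _ _ hε]
  refine ⟨α, ⟨?_, ?_⟩, ?_⟩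
  · intro x ε hε
    let L : EG →L[ℝ] EM := mfderiv 𝓘(ℝ, EG) 𝓘(ℝ, EM) 𝓖.source (𝓖.unit (Φ.base (x, ε)))
    have hL : HasMFDerivAt 𝓘(ℝ, EG) 𝓘(ℝ, EM) 𝓖.source (𝓖.unit (Φ.base (x, ε))) L :=
      (𝓖.contMDiff_source.mdifferentiableAt (by simp)).hasMFDerivAt
    have h1 := HasVelocity.comp hL (hα x ε hε) (hbase x ε hε)
    have h2 : HasVelocity 𝓘(ℝ, EM)
        (fun t => 𝓖.source (𝓖.mul (τ (x, t)) (𝓖.inv (τ (x, ε))))) (0 : EM) ε :=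
      (HasVelocity.const (Φ.base (x, ε)) ε).congr
        (by filter_upwards [hJ.mem_nhds hε] with t ht using hsrc x ε hε t ht)
    exact h1.unique h2
  · have h1 := contMDiffOn_partial_velocity (I := 𝓘(ℝ, EN).prod 𝓘(ℝ, ℝ)) (T := univ ×ˢ J)
      ((isOpen_univ.prod hJ).prod hJ) hθ contMDiff_snd (fun p hp => ⟨hp, hp.2⟩) (v := α)
      (fun p hp => hα p.1 p.2 hp.2)
    refine h1.congr ?_
    rintro ⟨x, ε⟩ ⟨_, hε⟩
    have h2 : ∀ (g k : G) (v : EG), g = k →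
        (⟨g, v⟩ : TangentBundle 𝓘(ℝ, EG) G) = ⟨k, v⟩ := by
      rintro g k v rfl
      rfl
    exact h2 _ _ _ (hbase x ε hε).symm
  · intro ε hε h
    have hev : ∀ᶠ t in 𝓝 ε, t ∈ J := hJ.mem_nhds hε
    have h1 := LieGroupoid.hasVelocity_mul_mul_inv (g := Φ.toFun (h, ε)) (hα (𝓗.target h) ε hε)
      (hα (𝓗.source h) ε hε) (hbase _ ε hε) (hbase _ ε hε) (hev.mono (hsrc _ ε hε))
      (hev.mono (hsrc _ ε hε)) ((Φ.isHom ε (hJI hε)).target_map h)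
      ((Φ.isHom ε (hJI hε)).source_map h)
    have h2 : HasVelocity 𝓘(ℝ, EG) (fun t => Φ.toFun (h, t))
        (𝓖.infinitesimalAction (Φ.base (𝓗.target h, ε)) (Φ.base (𝓗.source h, ε)) (Φ.toFun (h, ε))
          (α (𝓗.target h, ε)) (α (𝓗.source h, ε))) ε := by
      refine h1.congr (hev.mono fun t ht => ?_)
      have hA : ∀ x, 𝓖.source (τ (x, t)) = 𝓖.source (τ (x, ε)) := fun x => by
        rw [hτs _ _ ht, hτs _ _ hε]
      have hB : ∀ x, 𝓖.source (τ (x, t)) = 𝓖.target (𝓖.inv (τ (x, ε))) := fun x => by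
        rw [𝓖.target_inv, hA]
      change Φ.toFun (h, t) = 𝓖.mul (𝓖.mul (𝓖.mul (τ (𝓗.target h, t))
        (𝓖.inv (τ (𝓗.target h, ε)))) (Φ.toFun (h, ε)))
        (𝓖.inv (𝓖.mul (τ (𝓗.source h, t)) (𝓖.inv (τ (𝓗.source h, ε)))))
      -- After substitution the factors `τ_ε⁻¹ τ_ε` on both sides of `Φ₀(h)` cancel.
      rw [hτΦ ε hε, hτΦ t ht, 𝓖.inv_mul_rev (hB _), 𝓖.inv_inv]
      have h3 : 𝓖.source (𝓖.mul (τ (𝓗.target h, t)) (𝓖.inv (τ (𝓗.target h, ε)))) =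
          𝓖.target (𝓖.mul (τ (𝓗.target h, ε)) (Φ₀.toFun h)) := by
        rw [𝓖.source_mul _ _ (hB _), 𝓖.source_inv, 𝓖.target_mul _ _ (hc1 ε hε h)]
      have h4 : 𝓖.source (𝓖.mul (τ (𝓗.source h, ε)) (𝓖.inv (τ (𝓗.source h, t)))) =
          𝓖.target (τ (𝓗.source h, t)) := by
        rw [𝓖.source_mul, 𝓖.source_inv]
        rw [𝓖.target_inv, hA]
      have h5 : 𝓖.source (𝓖.mul (τ (𝓗.target h, t)) (Φ₀.toFun h)) =
          𝓖.target (𝓖.inv (τ (𝓗.source h, ε))) := by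
        rw [𝓖.source_mul _ _ (hc1 t ht h), 𝓖.target_inv, hc2 ε hε h]
      have h6 : 𝓖.source (τ (𝓗.source h, ε)) = 𝓖.target (𝓖.inv (τ (𝓗.source h, t))) := by
        rw [𝓖.target_inv, hA]
      rw [← 𝓖.mul_assoc _ _ _ h3 (hc3 ε hε h), ← 𝓖.mul_assoc _ _ _
        (by rw [𝓖.source_mul _ _ (hB _), 𝓖.source_inv]) (hc1 ε hε h),
        𝓖.inv_mul_cancel_right (hA _), 𝓖.mul_assoc _ _ _ h5 ?_, 𝓖.inv_mul_cancel_left h6]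
      rw [𝓖.source_inv, 𝓖.target_mul _ _ h6]
    exact h2.mfderiv_one

end MorphismDeformation

end Forward

/-! ### Multiplication near a unit in a chart. -/

section ChartTranslation

open Set Filter Topology

namespace LieGroupoid

variable {EG EM G M : Type*}
  [NormedAddCommGroup EG] [NormedSpace ℝ EG] [NormedAddCommGroup EM] [NormedSpace ℝ EM]
  [TopologicalSpace G] [ChartedSpace EG G] [TopologicalSpace M] [ChartedSpace EM M]
  [IsManifold 𝓘(ℝ, EG) ∞ G] [IsManifold 𝓘(ℝ, EM) ∞ M]

/-- The multiplication near a unit, read in a chart `e` in which the target map becomes linear and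
extended to a smooth map `B` on an open set. -/
theorem exists_chart_multiplication (𝓖 : LieGroupoid EG EM G M) (y : M) :
    ∃ (e : OpenPartialHomeomorph G EG) (e' : OpenPartialHomeomorph M EM) (π : EG →L[ℝ] EM)
      (B : EG × EG → EG) (D : Set (EG × EG)), e ∈ IsManifold.maximalAtlas 𝓘(ℝ, EG) ∞ G ∧
      e' ∈ IsManifold.maximalAtlas 𝓘(ℝ, EM) ∞ M ∧ 𝓖.unit y ∈ e.source ∧
      (∀ k ∈ e.source, 𝓖.target k ∈ e'.source ∧ e' (𝓖.target k) = π (e k)) ∧ IsOpen D ∧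
      (e (𝓖.unit y), e (𝓖.unit y)) ∈ D ∧ ContDiffOn ℝ ∞ B D ∧
      (∀ q ∈ D, q.2 ∈ e.target ∧ B q ∈ e.target ∧ π (B q) = π q.1) ∧
      ∀ k ∈ e.source, ∀ g ∈ e.source, (e k, e g) ∈ D → 𝓖.source k = 𝓖.target g →
        e.symm (B (e k, e g)) = 𝓖.mul k g := by
  obtain ⟨e, e', π, ρ, O, he, he', hg, hπ, hO, hmem, hρ, hρ1, hρ2⟩ :=
    𝓖.isSubmersion_target.exists_charts_retraction (𝓖.unit y)
  let j : G × G → M × G := fun q => (𝓖.source q.1, q.2)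
  have hj : ContMDiff (𝓘(ℝ, EG).prod 𝓘(ℝ, EG)) (𝓘(ℝ, EM).prod 𝓘(ℝ, EG)) ∞ j :=
    (𝓖.contMDiff_source.comp contMDiff_fst).prodMk contMDiff_snd
  -- The second factor is first retracted onto the target fibre over the source of the first, so `m`
  -- is defined on an open set of pairs and agrees with the product on composable ones.
  let m : G × G → G := fun q => 𝓖.mul q.1 (ρ (j q))
  have hO' : IsOpen (j ⁻¹' O) := hO.preimage hj.continuous
  have hcomp : ∀ q ∈ j ⁻¹' O, 𝓖.source q.1 = 𝓖.target (ρ (j q)) := fun q hq => (hρ1 _ hq).symm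
  have hm : ContMDiffOn (𝓘(ℝ, EG).prod 𝓘(ℝ, EG)) 𝓘(ℝ, EG) ∞ m (j ⁻¹' O) :=
    𝓖.contMDiffOn_mul_comp contMDiffOn_fst (hρ.comp hj.contMDiffOn fun q hq => hq) hcomp
  let S : Set (G × G) := j ⁻¹' O ∩ m ⁻¹' e.source
  have hS : IsOpen S := hm.continuousOn.isOpen_inter_preimage hO' e.open_source
  let ee := e.prod e
  let D : Set (EG × EG) := ee.target ∩ ee.symm ⁻¹' S
  have hD : IsOpen D := ee.symm.continuousOn.isOpen_inter_preimage ee.open_target hS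
  have hmS : ∀ k g, (k, g) ∈ S → 𝓖.source k = 𝓖.target g → m (k, g) = 𝓖.mul k g := by
    intro k g hq hkg
    have hq1 : (𝓖.target g, g) ∈ O := by rw [← hkg]; exact hq.1
    change 𝓖.mul k (ρ (𝓖.source k, g)) = 𝓖.mul k g
    rw [hkg, hρ2 _ hq1]
  have hsymm : ContMDiffOn 𝓘(ℝ, EG × EG) (𝓘(ℝ, EG).prod 𝓘(ℝ, EG)) ∞ ee.symm D := by
    rw [modelWithCornersSelf_prod, ← chartedSpaceSelf_prod]
    have h := contMDiffOn_symm_of_mem_maximalAtlas he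
    exact (h.comp contMDiffOn_fst fun q hq => hq.1.1).prodMk
      (h.comp contMDiffOn_snd fun q hq => hq.1.2)
  refine ⟨e, e', π, fun q => e (m (ee.symm q)), D, he, he', hg, hπ, hD, ?_, ?_, ?_, ?_⟩
  · have h1 : ((e (𝓖.unit y), e (𝓖.unit y)) : EG × EG) = ee (𝓖.unit y, 𝓖.unit y) := rfl
    have h2 : (𝓖.unit y, 𝓖.unit y) ∈ ee.source := ⟨hg, hg⟩
    rw [h1]
    refine ⟨ee.map_source h2, ?_⟩
    rw [mem_preimage, ee.left_inv h2]
    have hj0 : j (𝓖.unit y, 𝓖.unit y) = (𝓖.target (𝓖.unit y), 𝓖.unit y) := by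
      simp [j, 𝓖.source_unit, 𝓖.target_unit]
    have hj1 : (𝓖.unit y, 𝓖.unit y) ∈ j ⁻¹' O := by rw [mem_preimage, hj0]; exact hmem
    refine ⟨hj1, ?_⟩
    change 𝓖.mul (𝓖.unit y) (ρ (j (𝓖.unit y, 𝓖.unit y))) ∈ e.source
    rw [hj0, hρ2 _ hmem, 𝓖.unit_mul' (𝓖.target_unit y)]
    exact hg
  · rw [← contMDiffOn_iff_contDiffOn]
    exact (contMDiffOn_of_mem_maximalAtlas he).comp
      (hm.comp hsymm fun q hq => hq.2.1) fun q hq => hq.2.2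
  · rintro ⟨w, z⟩ ⟨⟨hw, hz⟩, hq⟩
    refine ⟨hz, e.map_source hq.2, ?_⟩
    have hw' := e.map_target hw
    rw [← (hπ _ hq.2).2]
    have h1 : 𝓖.target (m (ee.symm (w, z))) = 𝓖.target (e.symm w) :=
      𝓖.target_mul _ _ (hcomp _ hq.1)
    rw [h1, (hπ _ hw').2, e.right_inv hw]
  · intro k hk g hg hq hkg
    have h1 : ee.symm (e k, e g) = (k, g) := ee.left_inv (x := (k, g)) ⟨hk, hg⟩
    have h2 : (k, g) ∈ S := h1 ▸ hq.2
    dsimp only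
    rw [h1, e.left_inv h2.2, hmS k g h2 hkg]

end LieGroupoid

end ChartTranslation

/-! ### Families of solutions and chart representatives of sections. -/

section LocalSolution

open Set Filter Topology

variable {EN N EG EM G M : Type*}
  [NormedAddCommGroup EN] [NormedSpace ℝ EN]
  [NormedAddCommGroup EG] [NormedSpace ℝ EG]
  [NormedAddCommGroup EM] [NormedSpace ℝ EM]
  [TopologicalSpace N] [ChartedSpace EN N]
  [TopologicalSpace G] [ChartedSpace EG G] [TopologicalSpace M] [ChartedSpace EM M]

/-- `τ` is a smooth family, over `U × K`, of curves from `f x` to `φ (x, ε)` with the logarithmic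
derivative `α`. -/
structure IsLogSolution (𝓖 : LieGroupoid EG EM G M) (f : N → M) (φ : N × ℝ → M)
    (α : N × ℝ → EG) (U : Set N) (K : Set ℝ) (τ : N × ℝ → G) : Prop where
  contMDiffOn : ContMDiffOn (𝓘(ℝ, EN).prod 𝓘(ℝ, ℝ)) 𝓘(ℝ, EG) ∞ τ (U ×ˢ K)
  source_eq : ∀ x ∈ U, ∀ t ∈ K, 𝓖.source (τ (x, t)) = f x
  target_eq : ∀ x ∈ U, ∀ t ∈ K, 𝓖.target (τ (x, t)) = φ (x, t)
  log : ∀ x ∈ U, ∀ t ∈ K, 𝓖.HasLogVelocity (fun s => τ (x, s)) (α (x, t)) t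

theorem contMDiffOn_mfderiv_chart {EX HX X : Type*} [NormedAddCommGroup EX] [NormedSpace ℝ EX]
    [TopologicalSpace HX] {I : ModelWithCorners ℝ EX HX} [TopologicalSpace X] [ChartedSpace HX X]
    [IsManifold 𝓘(ℝ, EG) ∞ G]
    {e : OpenPartialHomeomorph G EG} (he : e ∈ IsManifold.maximalAtlas 𝓘(ℝ, EG) ∞ G) {T : Set X}
    {u : X → G} {v : X → EG} (hu : ∀ p ∈ T, u p ∈ e.source)
    (hv : ContMDiffOn I 𝓘(ℝ, EG).tangent ∞
      (fun p : X => (⟨u p, v p⟩ : TangentBundle 𝓘(ℝ, EG) G)) T) :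
    ∃ a : X → EG, ContMDiffOn I 𝓘(ℝ, EG) ∞ a T ∧ ∀ p ∈ T, ∀ (γ : ℝ → G) (t : ℝ), γ t = u p →
      HasVelocity 𝓘(ℝ, EG) γ (v p) t → HasVelocity 𝓘(ℝ, EG) (fun s => e (γ s)) (a p) t := by
  have hes := contMDiffOn_of_mem_maximalAtlas he
  have h1 := hes.contMDiffOn_tangentMapWithin (m := ∞) (by simp) e.open_source.uniqueMDiffOn
  have h2 := (contMDiff_snd_tangentBundle_modelSpace EG 𝓘(ℝ, EG) (n := ∞)).comp_contMDiffOn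
    (h1.comp hv hu)
  refine ⟨_, h2, fun p hp γ t hγ hγv => ?_⟩
  let L : EG →L[ℝ] EG := mfderivWithin 𝓘(ℝ, EG) 𝓘(ℝ, EG) e e.source (u p)
  have hL : HasMFDerivWithinAt 𝓘(ℝ, EG) 𝓘(ℝ, EG) e e.source (u p) L :=
    ((hes _ (hu p hp)).mdifferentiableWithinAt (by simp)).hasMFDerivWithinAt
  have h3 := HasVelocity.comp_within hL hγv hγ
    (hγv.continuousAt.eventually_mem (e.open_source.mem_nhds (hγ ▸ hu p hp)))
  exact h3

end LocalSolution

/-! ### Local existence of solutions starting at units. -/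

section LocalExistence

open Set Filter Topology

variable {EN N EG EM G M : Type*}
  [NormedAddCommGroup EN] [NormedSpace ℝ EN] [FiniteDimensional ℝ EN]
  [NormedAddCommGroup EG] [NormedSpace ℝ EG] [FiniteDimensional ℝ EG]
  [NormedAddCommGroup EM] [NormedSpace ℝ EM]
  [TopologicalSpace N] [ChartedSpace EN N] [IsManifold 𝓘(ℝ, EN) ∞ N]
  [TopologicalSpace G] [ChartedSpace EG G] [IsManifold 𝓘(ℝ, EG) ∞ G]
  [TopologicalSpace M] [ChartedSpace EM M] [IsManifold 𝓘(ℝ, EM) ∞ M]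
  {𝓖 : LieGroupoid EG EM G M} {φ : N × ℝ → M} {α : N × ℝ → EG} {J : Set ℝ}

/-- Solution, in a chart of the parameter manifold, of the differential equation
`z' = ∂₁B(b, z) a` with the initial value `b`. -/
theorem exists_contDiffOn_chart_solution {B : EG × EG → EG} {D : Set (EG × EG)} (hD : IsOpen D)
    (hB : ContDiffOn ℝ ∞ B D) {b a : N × ℝ → EG} {T : Set (N × ℝ)} (hT : IsOpen T)
    (hb : ContMDiffOn (𝓘(ℝ, EN).prod 𝓘(ℝ, ℝ)) 𝓘(ℝ, EG) ∞ b T)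
    (ha : ContMDiffOn (𝓘(ℝ, EN).prod 𝓘(ℝ, ℝ)) 𝓘(ℝ, EG) ∞ a T) {x₀ : N} {t₀ : ℝ}
    (hmem : (x₀, t₀) ∈ T) (hbD : (b (x₀, t₀), b (x₀, t₀)) ∈ D) :
    ∃ (z : N × ℝ → EG) (U : Set N) (δ : ℝ), IsOpen U ∧ x₀ ∈ U ∧ 0 < δ ∧
      ContMDiffOn (𝓘(ℝ, EN).prod 𝓘(ℝ, ℝ)) 𝓘(ℝ, EG) ∞ z (U ×ˢ Ioo (t₀ - δ) (t₀ + δ)) ∧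
      (∀ x ∈ U, z (x, t₀) = b (x, t₀)) ∧
      ∀ x ∈ U, ∀ t ∈ Ioo (t₀ - δ) (t₀ + δ), (x, t) ∈ T ∧ (b (x, t), z (x, t)) ∈ D ∧
        HasDerivAt (fun s => z (x, s)) (fderiv ℝ B (b (x, t), z (x, t)) (a (x, t), 0)) t := by
  let c := chartAt EN x₀
  let ι : EN × ℝ → N × ℝ := fun q => (c.symm q.1, q.2)
  have hι : ContMDiffOn 𝓘(ℝ, EN × ℝ) (𝓘(ℝ, EN).prod 𝓘(ℝ, ℝ)) ∞ ι (c.target ×ˢ univ) := by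
    rw [modelWithCornersSelf_prod, ← chartedSpaceSelf_prod]
    exact ((contMDiffOn_chart_symm (I := 𝓘(ℝ, EN)) (n := ∞) (x := x₀)).comp contMDiffOn_fst
      fun q hq => hq.1).prodMk contMDiffOn_snd
  let Q : Set (EN × ℝ) := (c.target ×ˢ univ) ∩ ι ⁻¹' T
  have hQ : IsOpen Q :=
    hι.continuousOn.isOpen_inter_preimage (c.open_target.prod isOpen_univ) hT
  have hb' : ContDiffOn ℝ ∞ (fun q => b (ι q)) Q := by
    rw [← contMDiffOn_iff_contDiffOn]
    exact hb.comp (hι.mono inter_subset_left) fun q hq => hq.2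
  have ha' : ContDiffOn ℝ ∞ (fun q => a (ι q)) Q := by
    rw [← contMDiffOn_iff_contDiffOn]
    exact ha.comp (hι.mono inter_subset_left) fun q hq => hq.2
  let k : EG × EN × ℝ → EG × EG := fun q => (b (ι q.2), q.1)
  have hk : ContDiffOn ℝ ∞ k (univ ×ˢ Q) :=
    (hb'.comp contDiffOn_snd fun q hq => hq.2).prodMk contDiffOn_fst
  let S : Set (EG × EN × ℝ) := (univ ×ˢ Q) ∩ k ⁻¹' D
  have hS : IsOpen S := hk.continuousOn.isOpen_inter_preimage (isOpen_univ.prod hQ) hD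
  have hW : ContDiffOn ℝ ∞ (fun q : EG × EN × ℝ => fderiv ℝ B (k q) (a (ι q.2), 0)) S := by
    have h1 : ContDiffOn ℝ ∞ (fun q => fderiv ℝ B (k q)) S :=
      (hB.fderiv_of_isOpen hD (by simp)).comp (hk.mono inter_subset_left) fun q hq => hq.2
    exact h1.clm_apply ((ha'.comp contDiffOn_snd fun q hq => hq.1.2).prodMk contDiffOn_const)
  have hc₀ : c.symm (c x₀) = x₀ := c.left_inv (mem_chart_source EN x₀)
  have hA : IsOpen ((fun p : EN => (p, t₀)) ⁻¹' Q) := hQ.preimage (by fun_prop)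
  have hmemQ : (c x₀, t₀) ∈ Q := by
    refine ⟨⟨c.map_source (mem_chart_source EN x₀), trivial⟩, ?_⟩
    change (c.symm (c x₀), t₀) ∈ T
    rwa [hc₀]
  obtain ⟨z, V, δ, hV, hxV, hVA, hδ, hz, hz0, hzd⟩ := exists_contDiffOn_parametric_solution hS hW
    (z₀ := fun p => b (ι (p, t₀))) hA
    (hb'.comp (contDiff_id.prodMk contDiff_const).contDiffOn fun p hp => hp) (p₀ := c x₀)
    (t₀ := t₀) hmemQ ⟨⟨trivial, hmemQ⟩, by
      change (b (c.symm (c x₀), t₀), b (c.symm (c x₀), t₀)) ∈ D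
      rwa [hc₀]⟩
  have hinv : ∀ x ∈ c.source, ∀ t, ι (c x, t) = (x, t) := fun x hx t => by
    simp only [ι, c.left_inv hx]
  refine ⟨fun q => z (c q.1, q.2), c.source ∩ c ⁻¹' V, δ,
    c.continuousOn.isOpen_inter_preimage c.open_source hV, ⟨mem_chart_source EN x₀, hxV⟩, hδ,
    ?_, ?_, ?_⟩
  · have h1 : ContMDiffOn (𝓘(ℝ, EN).prod 𝓘(ℝ, ℝ)) 𝓘(ℝ, EN × ℝ) ∞ (fun q : N × ℝ => (c q.1, q.2))
        (c.source ×ˢ univ) :=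
      ((contMDiffOn_chart (I := 𝓘(ℝ, EN)) (n := ∞) (x := x₀)).comp contMDiffOn_fst
        fun q hq => hq.1).prodMk_space contMDiffOn_snd
    exact hz.contMDiffOn.comp (h1.mono fun q hq => ⟨hq.1.1, trivial⟩)
      fun q hq => ⟨hq.1.2, hq.2⟩
  · rintro x ⟨hx, hxV⟩
    change z (c x, t₀) = b (x, t₀)
    rw [hz0 _ hxV, hinv x hx]
  · rintro x ⟨hx, hxV⟩ t ht
    obtain ⟨⟨⟨-, hq⟩, hkD⟩, hd⟩ := hzd _ hxV t ht
    have hqT := hq.2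
    simp only [k, mem_preimage, hinv x hx] at hkD hd hqT
    exact ⟨hqT, hkD, hd⟩

/-- In a chart, right translation of `α` is `∂₁B(b, z) a`, with `b` the unit over `φ` and `a`
representing `α`. This makes sense even when `z` is not composable with `b`. The hypothesis on the
anchor shows that the solution stays over `φ`, where the extended multiplication is the true one. -/
theorem exists_isLogSolution (hJ : IsOpen J)
    (hφ : ContMDiffOn (𝓘(ℝ, EN).prod 𝓘(ℝ, ℝ)) 𝓘(ℝ, EM) ∞ φ (univ ×ˢ J))
    (hαmem : ∀ x, ∀ t ∈ J, α (x, t) ∈ 𝓖.algebroidFiber (φ (x, t)))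
    (hα : ContMDiffOn (𝓘(ℝ, EN).prod 𝓘(ℝ, ℝ)) 𝓘(ℝ, EG).tangent ∞
      (fun p : N × ℝ => (⟨𝓖.unit (φ p), α p⟩ : TangentBundle 𝓘(ℝ, EG) G)) (univ ×ˢ J))
    (hanchor : ∀ x, ∀ t ∈ J, ∀ γ : ℝ → G, γ t = 𝓖.unit (φ (x, t)) →
      HasVelocity 𝓘(ℝ, EG) γ (α (x, t)) t → ∃ v : EM,
        HasVelocity 𝓘(ℝ, EM) (fun s => 𝓖.target (γ s)) v t ∧
        HasVelocity 𝓘(ℝ, EM) (fun s => φ (x, s)) v t) (x₀ : N) {t₀ : ℝ} (ht₀ : t₀ ∈ J) :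
    ∃ (σ : N × ℝ → G) (U : Set N) (δ : ℝ), IsOpen U ∧ x₀ ∈ U ∧ 0 < δ ∧
      Ioo (t₀ - δ) (t₀ + δ) ⊆ J ∧
      IsLogSolution (EN := EN) 𝓖 (fun x => φ (x, t₀)) φ α U (Ioo (t₀ - δ) (t₀ + δ)) σ ∧
      ∀ x ∈ U, σ (x, t₀) = 𝓖.unit (φ (x, t₀)) := by
  obtain ⟨e, e', π, B, D, he, he', hu₀, hπ, hD, huD, hB, hBD, hBmul⟩ :=
    𝓖.exists_chart_multiplication (φ (x₀, t₀))
  have hes := contMDiffOn_of_mem_maximalAtlas he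
  have hess := contMDiffOn_symm_of_mem_maximalAtlas he
  have hes' := contMDiffOn_of_mem_maximalAtlas he'
  have hu : ContMDiffOn (𝓘(ℝ, EN).prod 𝓘(ℝ, ℝ)) 𝓘(ℝ, EG) ∞ (fun p => 𝓖.unit (φ p)) (univ ×ˢ J) :=
    𝓖.contMDiff_unit.comp_contMDiffOn hφ
  let T : Set (N × ℝ) := (univ ×ˢ J) ∩ (fun p => 𝓖.unit (φ p)) ⁻¹' e.source
  have hT : IsOpen T :=
    hu.continuousOn.isOpen_inter_preimage (isOpen_univ.prod hJ) e.open_source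
  let b : N × ℝ → EG := fun p => e (𝓖.unit (φ p))
  have hb : ContMDiffOn (𝓘(ℝ, EN).prod 𝓘(ℝ, ℝ)) 𝓘(ℝ, EG) ∞ b T :=
    hes.comp (hu.mono inter_subset_left) fun p hp => hp.2
  obtain ⟨a, ha, hav⟩ := contMDiffOn_mfderiv_chart he (T := T) (fun p hp => hp.2)
    (hα.mono inter_subset_left)
  obtain ⟨z, U, δ, hU, hxU, hδ, hz, hz0, hzd⟩ := exists_contDiffOn_chart_solution hD hB hT hb ha
    (x₀ := x₀) (t₀ := t₀) ⟨⟨trivial, ht₀⟩, hu₀⟩ huD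
  set K := Ioo (t₀ - δ) (t₀ + δ) with hK
  have ht₀K : t₀ ∈ K := ⟨by linarith, by linarith⟩
  have hKJ : K ⊆ J := fun t ht => (hzd x₀ hxU t ht).1.1.2
  have hKn : ∀ t ∈ K, ∀ᶠ s in 𝓝 t, s ∈ K := fun t ht => isOpen_Ioo.mem_nhds ht
  have hztar : ∀ x ∈ U, ∀ t ∈ K, z (x, t) ∈ e.target := fun x hx t ht =>
    (hBD _ (hzd x hx t ht).2.1).1
  have hσsrc : ∀ x ∈ U, ∀ t ∈ K, e.symm (z (x, t)) ∈ e.source := fun x hx t ht =>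
    e.map_target (hztar x hx t ht)
  have hW : ∀ x ∈ U, ∀ t ∈ K, ∀ γ : ℝ → G, γ t = 𝓖.unit (φ (x, t)) →
      HasVelocity 𝓘(ℝ, EG) γ (α (x, t)) t → HasDerivAt (fun s => B (e (γ s), z (x, t)))
        (fderiv ℝ B (b (x, t), z (x, t)) (a (x, t), 0)) t ∧
        (∀ᶠ s in 𝓝 t, γ s ∈ e.source ∧ (e (γ s), z (x, t)) ∈ D) ∧
        HasDerivAt (fun s => e (γ s)) (a (x, t)) t := by
    intro x hx t ht γ hγ hγv
    obtain ⟨hmT, hmD, -⟩ := hzd x hx t ht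
    have h1 : HasDerivAt (fun s => e (γ s)) (a (x, t)) t := (hav _ hmT γ t hγ hγv).hasDerivAt
    have h2 : HasDerivAt (fun s => (e (γ s), z (x, t))) (a (x, t), (0 : EG)) t :=
      h1.prodMk (hasDerivAt_const t _)
    have hbγ : (e (γ t), z (x, t)) = (b (x, t), z (x, t)) := by rw [hγ]
    have h3 : HasFDerivAt B (fderiv ℝ B (b (x, t), z (x, t))) (e (γ t), z (x, t)) := by
      rw [hbγ]
      exact ((hB.contDiffAt (hD.mem_nhds hmD)).differentiableAt (by simp)).hasFDerivAt
    refine ⟨h3.comp_hasDerivAt t h2, ?_, h1⟩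
    refine (hγv.continuousAt.eventually_mem (e.open_source.mem_nhds ?_)).and
      (h2.continuousAt.eventually_mem (hD.mem_nhds ?_))
    · rw [hγ]; exact hmT.2
    · rw [hbγ]; exact hmD
  -- In coordinates the target of `B(w, z)` is `π w`. So `π z` and the coordinates of `φ` both move
  -- with the anchor of `α`, and they agree at `t₀`.
  have htarget : ∀ x ∈ U, ∀ t ∈ K, 𝓖.target (e.symm (z (x, t))) = φ (x, t) := by
    intro x hx t ht
    have hb' : ∀ s ∈ K, π (b (x, s)) = e' (φ (x, s)) ∧ φ (x, s) ∈ e'.source := by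
      intro s hs
      have h1 := hπ _ (hzd x hx s hs).1.2
      rw [𝓖.target_unit] at h1
      exact ⟨h1.2.symm, h1.1⟩
    have hd : ∀ s ∈ K, HasDerivAt (fun r => π (z (x, r)) - e' (φ (x, r))) 0 s := by
      intro s hs
      obtain ⟨γ, hγ, hγv⟩ := exists_hasVelocity (𝓖.unit (φ (x, s))) (α (x, s)) s
      obtain ⟨h1, h2, h3⟩ := hW x hx s hs γ hγ hγv
      have h4 : HasDerivAt (fun r => π (e (γ r)))
          (π (fderiv ℝ B (b (x, s), z (x, s)) (a (x, s), 0))) s :=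
        (π.hasFDerivAt.comp_hasDerivAt s h1).congr_of_eventuallyEq
          (h2.mono fun r hr => ((hBD _ hr.2).2.2).symm)
      obtain ⟨v, hv1, hv2⟩ := hanchor x s (hKJ hs) γ hγ hγv
      have hse : φ (x, s) ∈ e'.source := (hb' s hs).2
      obtain ⟨L, hL⟩ := exists_hasMFDerivAt
        ((hes'.contMDiffAt (e'.open_source.mem_nhds hse)).mdifferentiableAt (by simp))
      have h5 := (HasVelocity.comp hL hv1 (by rw [hγ, 𝓖.target_unit])).hasDerivAt
      have h6 := (HasVelocity.comp hL hv2 rfl).hasDerivAt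
      have h7 : HasDerivAt (fun r => π (e (γ r))) (L v) s :=
        h5.congr_of_eventuallyEq (h2.mono fun r hr => (hπ _ hr.1).2.symm)
      have h8 := (π.hasFDerivAt.comp_hasDerivAt s (hzd x hx s hs).2.2).sub h6
      exact h8.congr_deriv (by rw [h4.unique h7, sub_self])
    have h0 := isOpen_Ioo.is_const_of_deriv_eq_zero isPreconnected_Ioo
      (fun s hs => (hd s hs).differentiableAt.differentiableWithinAt)
      (fun s hs => (hd s hs).deriv) ht ht₀K
    simp only [hz0 x hx, (hb' t₀ ht₀K).1, sub_self] at h0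
    have h1 := hπ _ (hσsrc x hx t ht)
    rw [e.right_inv (hztar x hx t ht)] at h1
    exact e'.injOn h1.1 (hb' t ht).2 (h1.2.trans (sub_eq_zero.1 h0))
  -- With the target known, `B` is genuine multiplication along a curve `c` in the source fibre, so
  -- the solution has the velocity of `c` times the current arrow.
  have hvel : ∀ x ∈ U, ∀ t ∈ K, ∃ (c : ℝ → G) (v : EG), c t = 𝓖.unit (φ (x, t)) ∧
      (∀ s, 𝓖.source (c s) = φ (x, t)) ∧ HasVelocity 𝓘(ℝ, EG) c (α (x, t)) t ∧
      HasVelocity 𝓘(ℝ, EG) (fun s => e.symm (z (x, s))) v t ∧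
      HasVelocity 𝓘(ℝ, EG) (fun s => 𝓖.mul (c s) (e.symm (z (x, t)))) v t := by
    intro x hx t ht
    obtain ⟨c, hc0, hcs, hcv⟩ := 𝓖.exists_hasVelocity_source_eq (hαmem x t (hKJ ht)) t
    obtain ⟨h1, h2, -⟩ := hW x hx t ht c hc0 hcv
    have hzt := hztar x hx t ht
    obtain ⟨L, hL⟩ := exists_hasMFDerivAt
      ((hess.contMDiffAt (e.open_target.mem_nhds hzt)).mdifferentiableAt (by simp))
    have h3 := HasVelocity.comp hL (HasVelocity.of_hasDerivAt (hzd x hx t ht).2.2) rfl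
    have hBt : B (e (c t), z (x, t)) = z (x, t) := by
      have h4 := h2.self_of_nhds
      have h5 := hBmul _ h4.1 _ (hσsrc x hx t ht) (by rw [e.right_inv hzt]; exact h4.2)
        (by rw [hcs, htarget x hx t ht])
      rw [e.right_inv hzt, hc0, 𝓖.unit_mul' (htarget x hx t ht)] at h5
      rw [hc0]
      refine e.symm.injOn (hBD _ ?_).2.1 hzt h5
      rw [← hc0]; exact h4.2
    have h6 := HasVelocity.comp hL (HasVelocity.of_hasDerivAt h1) hBt
    refine ⟨c, _, hc0, hcs, hcv, h3, h6.congr (h2.mono fun s hs => ?_)⟩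
    have h5 := hBmul _ hs.1 _ (hσsrc x hx t ht) (by rw [e.right_inv hzt]; exact hs.2)
      (by rw [hcs, htarget x hx t ht])
    rw [e.right_inv hzt] at h5
    exact h5.symm
  have hinit : ∀ x ∈ U, e.symm (z (x, t₀)) = 𝓖.unit (φ (x, t₀)) := by
    intro x hx
    rw [hz0 x hx]
    exact e.left_inv (hzd x hx t₀ ht₀K).1.2
  -- Left factors do not change the source, so its velocity vanishes.
  have hsource : ∀ x ∈ U, ∀ t ∈ K, 𝓖.source (e.symm (z (x, t))) = φ (x, t₀) := by
    intro x hx t ht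
    have hd : ∀ s ∈ K, HasVelocity 𝓘(ℝ, EM) (fun r => 𝓖.source (e.symm (z (x, r)))) 0 s := by
      intro s hs
      obtain ⟨c, v, hc0, hcs, hcv, h1, h2⟩ := hvel x hx s hs
      have htar := htarget x hx s hs
      obtain ⟨L, hL⟩ := exists_hasMFDerivAt (𝓖.contMDiff_source.mdifferentiableAt
        (x := e.symm (z (x, s))) (by simp))
      have h3 := HasVelocity.comp hL h1 rfl
      have h4 := HasVelocity.comp hL h2 (by rw [hc0, 𝓖.unit_mul' htar])
      have h5 : HasVelocity 𝓘(ℝ, EM)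
          (fun r => 𝓖.source (𝓖.mul (c r) (e.symm (z (x, s))))) 0 s :=
        (HasVelocity.const (𝓖.source (e.symm (z (x, s)))) s).congr
          (Eventually.of_forall fun r => 𝓖.source_mul _ _ ((hcs r).trans htar.symm))
      rwa [h4.unique h5] at h3
    have h1 := eq_of_hasVelocity_zero (γ := fun r => 𝓖.source (e.symm (z (x, r)))) isOpen_Ioo
      isPreconnected_Ioo hd ht ht₀K
    simp only [hinit x hx, 𝓖.source_unit] at h1
    exact h1
  refine ⟨fun p => e.symm (z p), U, δ, hU, hxU, hδ, hKJ, ⟨?_, hsource, htarget, ?_⟩, hinit⟩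
  · exact hess.comp hz fun p hp => hztar p.1 hp.1 p.2 hp.2
  · intro x hx t ht
    obtain ⟨c, v, hc0, hcs, hcv, h1, h2⟩ := hvel x hx t ht
    have htar := htarget x hx t ht
    let S : Set G := {k | 𝓖.source k = 𝓖.source (e.symm (z (x, t)))}
    have hF : MDifferentiableWithinAt 𝓘(ℝ, EG) 𝓘(ℝ, EG)
        (fun k => 𝓖.mul k (𝓖.inv (e.symm (z (x, t))))) S (e.symm (z (x, t))) :=
      𝓖.mdifferentiableWithinAt_mul_comp mdifferentiableWithinAt_id mdifferentiableWithinAt_const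
        rfl fun k hk => (show 𝓖.source k = _ from hk).trans (𝓖.target_inv _).symm
    obtain ⟨L, hL⟩ := exists_hasMFDerivWithinAt hF
    have hcc : ∀ r, 𝓖.source (c r) = 𝓖.target (e.symm (z (x, t))) := fun r =>
      (hcs r).trans htar.symm
    have h3 := HasVelocity.comp_within hL h1 rfl ((hKn t ht).mono fun s hs =>
      (hsource x hx s hs).trans (hsource x hx t ht).symm)
    have h4 := HasVelocity.comp_within hL h2 (by rw [hc0, 𝓖.unit_mul' htar])
      (Eventually.of_forall fun r => 𝓖.source_mul _ _ (hcc r))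
    have h5 : HasVelocity 𝓘(ℝ, EG) (fun r => 𝓖.mul (𝓖.mul (c r) (e.symm (z (x, t))))
        (𝓖.inv (e.symm (z (x, t))))) (α (x, t)) t :=
      hcv.congr (Eventually.of_forall fun r => 𝓖.mul_inv_cancel_right (hcc r))
    rw [h4.unique h5] at h3
    exact h3

end LocalExistence

/-! ### Continuation in time and gluing over the base. -/

section Gluing

open Set Filter Topology

variable {EN N EG EM G M : Type*}
  [NormedAddCommGroup EN] [NormedSpace ℝ EN] [NormedAddCommGroup EG] [NormedSpace ℝ EG]
  [NormedAddCommGroup EM] [NormedSpace ℝ EM]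
  [TopologicalSpace N] [ChartedSpace EN N] [TopologicalSpace G] [ChartedSpace EG G]
  [TopologicalSpace M] [ChartedSpace EM M]
  {𝓖 : LieGroupoid EG EM G M} {f : N → M} {φ : N × ℝ → M} {α : N × ℝ → EG}
  {U U' : Set N} {K K' J : Set ℝ} {τ τ' σ : N × ℝ → G}

namespace IsLogSolution

theorem mono (h : IsLogSolution (EN := EN) 𝓖 f φ α U K τ) (hU : U' ⊆ U) (hK : K' ⊆ K) :
    IsLogSolution (EN := EN) 𝓖 f φ α U' K' τ where
  contMDiffOn := h.contMDiffOn.mono (prod_mono hU hK)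
  source_eq x hx t ht := h.source_eq x (hU hx) t (hK ht)
  target_eq x hx t ht := h.target_eq x (hU hx) t (hK ht)
  log x hx t ht := h.log x (hU hx) t (hK ht)

theorem of_locally (h : ∀ x ∈ U, ∀ t ∈ K, ∃ (U' : Set N) (K' : Set ℝ) (τ' : N × ℝ → G),
    IsOpen U' ∧ x ∈ U' ∧ IsOpen K' ∧ t ∈ K' ∧ IsLogSolution (EN := EN) 𝓖 f φ α U' K' τ' ∧
      EqOn τ τ' (U' ×ˢ K')) : IsLogSolution (EN := EN) 𝓖 f φ α U K τ where
  contMDiffOn := by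
    rintro ⟨x, t⟩ ⟨hx, ht⟩
    obtain ⟨U', K', τ', hU', hxU, hK', htK, h', heq⟩ := h x hx t ht
    have hn := (hU'.prod hK').mem_nhds (mk_mem_prod hxU htK)
    exact ((h'.contMDiffOn.contMDiffAt hn).congr_of_eventuallyEq
      (eventually_of_mem hn heq)).contMDiffWithinAt
  source_eq x hx t ht := by
    obtain ⟨U', K', τ', hU', hxU, hK', htK, h', heq⟩ := h x hx t ht
    rw [heq (mk_mem_prod hxU htK), h'.source_eq x hxU t htK]
  target_eq x hx t ht := by
    obtain ⟨U', K', τ', hU', hxU, hK', htK, h', heq⟩ := h x hx t ht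
    rw [heq (mk_mem_prod hxU htK), h'.target_eq x hxU t htK]
  log x hx t ht := by
    obtain ⟨U', K', τ', hU', hxU, hK', htK, h', heq⟩ := h x hx t ht
    exact (h'.log x hxU t htK).congr
      (eventually_of_mem (hK'.mem_nhds htK) fun s hs => heq (mk_mem_prod hxU hs))

theorem mul_right (h : IsLogSolution (EN := EN) 𝓖 f φ α U K τ) (hK : IsOpen K) {g : N → G}
    (hg : ContMDiffOn 𝓘(ℝ, EN) 𝓘(ℝ, EG) ∞ g U) (hgt : ∀ x ∈ U, 𝓖.target (g x) = f x) :
    IsLogSolution (EN := EN) 𝓖 (fun x => 𝓖.source (g x)) φ α U K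
      (fun p => 𝓖.mul (τ p) (g p.1)) := by
  have hc : ∀ x ∈ U, ∀ t ∈ K, 𝓖.source (τ (x, t)) = 𝓖.target (g x) := fun x hx t ht => by
    rw [h.source_eq x hx t ht, hgt x hx]
  refine ⟨?_, fun x hx t ht => 𝓖.source_mul _ _ (hc x hx t ht), fun x hx t ht => ?_,
    fun x hx t ht => ?_⟩
  · exact 𝓖.contMDiffOn_mul_comp h.contMDiffOn (hg.comp contMDiffOn_fst fun p hp => hp.1)
      fun p hp => hc p.1 hp.1 p.2 hp.2
  · exact (𝓖.target_mul _ _ (hc x hx t ht)).trans (h.target_eq x hx t ht)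
  · exact (h.log x hx t ht).mul_right (eventually_of_mem (hK.mem_nhds ht) (hc x hx))

theorem eqOn [IsManifold 𝓘(ℝ, EG) ∞ G] (h : IsLogSolution (EN := EN) 𝓖 f φ α U K τ)
    (h' : IsLogSolution (EN := EN) 𝓖 f φ α U' K' τ') (hK : IsOpen K) (hK' : IsOpen K')
    (hKc : OrdConnected K) (hKc' : OrdConnected K') {x : N} (hx : x ∈ U) (hx' : x ∈ U') {e : ℝ}
    (he : e ∈ K) (he' : e ∈ K') (heq : τ (x, e) = τ' (x, e)) {t : ℝ} (ht : t ∈ K) (ht' : t ∈ K') :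
    τ (x, t) = τ' (x, t) :=
  LieGroupoid.eqOn_of_hasLogVelocity (τ := fun s => τ (x, s)) (σ := fun s => τ' (x, s))
    (α := fun s => α (x, s)) (hK.inter hK') (hKc.inter hKc').isPreconnected
    (fun s hs => h.source_eq x hx s hs.1) (fun s hs => h'.source_eq x hx' s hs.2)
    (fun s hs => (h'.target_eq x hx' s hs.2).trans (h.target_eq x hx s hs.1).symm)
    (fun s hs => h.log x hx s hs.1) (fun s hs => h'.log x hx' s hs.2) ⟨he, he'⟩ heq ⟨ht, ht'⟩

/-- The translate of `σ` by `σ(b)⁻¹ τ(b)` is a solution that agrees with `τ` at time `b`, hence on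
the whole overlap of the two intervals. -/
theorem exists_union [IsManifold 𝓘(ℝ, EG) ∞ G] {f' : N → M}
    (h : IsLogSolution (EN := EN) 𝓖 f φ α U K τ) (hσ : IsLogSolution (EN := EN) 𝓖 f' φ α U' K' σ)
    (hU : IsOpen U) (hU' : IsOpen U') (hK : IsOpen K) (hK' : IsOpen K') (hKc : OrdConnected K)
    (hKc' : OrdConnected K') {b : ℝ} (hb : b ∈ K) (hb' : b ∈ K') :
    ∃ ρ : N × ℝ → G, IsLogSolution (EN := EN) 𝓖 f φ α (U ∩ U') (K ∪ K') ρ ∧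
      ∀ x, ∀ t ∈ K, ρ (x, t) = τ (x, t) := by
  have hc : ∀ x ∈ U ∩ U', 𝓖.source (𝓖.inv (σ (x, b))) = 𝓖.target (τ (x, b)) := fun x hx => by
    rw [𝓖.source_inv, hσ.target_eq x hx.2 b hb', h.target_eq x hx.1 b hb]
  have hi : ContMDiff 𝓘(ℝ, EN) (𝓘(ℝ, EN).prod 𝓘(ℝ, ℝ)) ∞ (fun x : N => (x, b)) :=
    contMDiff_id.prodMk contMDiff_const
  let g : N → G := fun x => 𝓖.mul (𝓖.inv (σ (x, b))) (τ (x, b))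
  have hg : ContMDiffOn 𝓘(ℝ, EN) 𝓘(ℝ, EG) ∞ g (U ∩ U') :=
    𝓖.contMDiffOn_mul_comp (𝓖.contMDiffOn_inv_comp
      (hσ.contMDiffOn.comp hi.contMDiffOn fun x hx => ⟨hx.2, hb'⟩))
      (h.contMDiffOn.comp hi.contMDiffOn fun x hx => ⟨hx.1, hb⟩) hc
  have h1 := (hσ.mono (inter_subset_right (s := U)) subset_rfl).mul_right hK' hg fun x hx => by
    rw [𝓖.target_mul _ _ (hc x hx), 𝓖.target_inv, hσ.source_eq x hx.2 b hb']
  have h2 : IsLogSolution (EN := EN) 𝓖 f φ α (U ∩ U') K' (fun p => 𝓖.mul (σ p) (g p.1)) := by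
    refine ⟨h1.contMDiffOn, fun x hx t ht => (h1.source_eq x hx t ht).trans ?_, h1.target_eq,
      h1.log⟩
    rw [𝓖.source_mul _ _ (hc x hx), h.source_eq x hx.1 b hb]
  have heq : ∀ x ∈ U ∩ U', ∀ t ∈ K, t ∈ K' → τ (x, t) = 𝓖.mul (σ (x, t)) (g x) := by
    intro x hx t ht ht'
    refine h.eqOn h2 hK hK' hKc hKc' hx.1 hx hb hb' ?_ ht ht'
    exact (𝓖.mul_inv_cancel_left ((𝓖.source_inv _).symm.trans (hc x hx))).symm
  classical
  let ρ : N × ℝ → G := fun p => if p.2 ∈ K then τ p else 𝓖.mul (σ p) (g p.1)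
  refine ⟨ρ, of_locally fun x hx t ht => ?_, fun x t ht => if_pos ht⟩
  rcases ht with ht | ht
  · exact ⟨U, K, τ, hU, hx.1, hK, ht, h, fun p hp => if_pos hp.2⟩
  · refine ⟨U ∩ U', K', _, hU.inter hU', hx, hK', ht, h2, ?_⟩
    rintro ⟨y, s⟩ ⟨hy, hs⟩
    by_cases hsK : s ∈ K
    · exact (if_pos hsK).trans (heq y hy s hsK hs)
    · exact if_neg hsK

/-- Local solutions around all times propagate a solution near a point over the whole interval. -/
theorem exists_of_forall_local [IsManifold 𝓘(ℝ, EG) ∞ G] (hJc : OrdConnected J) (h0 : (0 : ℝ) ∈ J)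
    {x₀ : N}
    (hloc : ∀ t₀ ∈ J, ∃ (σ : N × ℝ → G) (U : Set N) (δ : ℝ), IsOpen U ∧ x₀ ∈ U ∧ 0 < δ ∧
      Ioo (t₀ - δ) (t₀ + δ) ⊆ J ∧
      IsLogSolution (EN := EN) 𝓖 (fun x => φ (x, t₀)) φ α U (Ioo (t₀ - δ) (t₀ + δ)) σ ∧
      ∀ x ∈ U, σ (x, t₀) = 𝓖.unit (φ (x, t₀))) {t : ℝ} (ht : t ∈ J) :
    ∃ (U : Set N) (K : Set ℝ) (τ : N × ℝ → G), IsOpen U ∧ x₀ ∈ U ∧ IsOpen K ∧ OrdConnected K ∧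
      0 ∈ K ∧ t ∈ K ∧ IsLogSolution (EN := EN) 𝓖 (fun x => φ (x, 0)) φ α U K τ ∧
      ∀ x ∈ U, τ (x, 0) = 𝓖.unit (φ (x, 0)) := by
  set A : Set ℝ := {t | ∃ (U : Set N) (K : Set ℝ) (τ : N × ℝ → G), IsOpen U ∧ x₀ ∈ U ∧ IsOpen K ∧
      OrdConnected K ∧ 0 ∈ K ∧ t ∈ K ∧ IsLogSolution (EN := EN) 𝓖 (fun x => φ (x, 0)) φ α U K τ ∧
      ∀ x ∈ U, τ (x, 0) = 𝓖.unit (φ (x, 0))} with hA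
  -- Each time has a neighbourhood lying entirely inside or entirely outside `A`. Thus `J ∩ A` and
  -- `J \ A` are open, and connectedness of `J` decides. The neighbourhood of `x₀` may shrink at
  -- each extension, as it is allowed to depend on `t`.
  have hext : ∀ t₀ ∈ J, ∃ V : Set ℝ, IsOpen V ∧ t₀ ∈ V ∧ V ⊆ J ∧ ∀ b ∈ V, b ∈ A → V ⊆ A := by
    intro t₀ ht₀
    obtain ⟨σ, U', δ, hU', hxU', hδ, hJ', hσ, -⟩ := hloc t₀ ht₀
    refine ⟨_, isOpen_Ioo, ⟨by linarith, by linarith⟩, hJ', fun b hb hbA s hs => ?_⟩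
    obtain ⟨U, K, τ, hU, hxU, hK, hKc, h0K, hbK, hτ, hτ0⟩ := hbA
    obtain ⟨ρ, hρ, hρτ⟩ := hτ.exists_union hσ hU hU' hK isOpen_Ioo hKc ordConnected_Ioo hbK hb
    refine ⟨_, _, ρ, hU.inter hU', ⟨hxU, hxU'⟩, hK.union isOpen_Ioo, ?_, Or.inl h0K, Or.inr hs, hρ,
      fun x hx => (hρτ x 0 h0K).trans (hτ0 x hx.1)⟩
    exact (hKc.isPreconnected.union b hbK hb isPreconnected_Ioo).ordConnected
  have h0A : (0 : ℝ) ∈ A := by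
    obtain ⟨σ, U, δ, hU, hxU, hδ, -, hσ, hσ0⟩ := hloc 0 h0
    have h0' : (0 : ℝ) ∈ Ioo (0 - δ) (0 + δ) := ⟨by linarith, by linarith⟩
    exact ⟨U, _, σ, hU, hxU, isOpen_Ioo, ordConnected_Ioo, h0', h0', hσ, hσ0⟩
  have h1 : IsOpen (J ∩ A) := isOpen_iff_mem_nhds.2 fun s hs => by
    obtain ⟨V, hV, hsV, hVJ, h⟩ := hext s hs.1
    exact mem_of_superset (hV.mem_nhds hsV) (subset_inter hVJ (h s hsV hs.2))
  have h2 : IsOpen (J \ A) := isOpen_iff_mem_nhds.2 fun s hs => by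
    obtain ⟨V, hV, hsV, hVJ, h⟩ := hext s hs.1
    exact mem_of_superset (hV.mem_nhds hsV) fun r hr => ⟨hVJ hr, fun hrA => hs.2 (h r hr hrA hsV)⟩
  exact (hJc.isPreconnected.subset_left_of_subset_union h1 h2
    (disjoint_left.2 fun s hs hs' => hs'.2 hs.2) (by rw [inter_union_sdiff]) ⟨0, h0, h0, h0A⟩ ht).2

/-- Solutions with the same value at time `0` agree on the common interval. So at each point the
value of an arbitrarily chosen local solution can be taken, and the result coincides locally with a
single one. -/
theorem exists_global [IsManifold 𝓘(ℝ, EG) ∞ G]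
    (h : ∀ x, ∀ t ∈ J, ∃ (U : Set N) (K : Set ℝ) (τ : N × ℝ → G), IsOpen U ∧ x ∈ U ∧ IsOpen K ∧
      OrdConnected K ∧ 0 ∈ K ∧ t ∈ K ∧ IsLogSolution (EN := EN) 𝓖 f φ α U K τ ∧
      ∀ y ∈ U, τ (y, 0) = 𝓖.unit (f y)) (h0 : (0 : ℝ) ∈ J) (hJ : IsOpen J) :
    ∃ τ : N × ℝ → G, IsLogSolution (EN := EN) 𝓖 f φ α univ J τ ∧
      ∀ x, τ (x, 0) = 𝓖.unit (f x) := by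
  choose U K τ hU hxU hK hKc h0K htK hτ hτ0 using h
  classical
  let ρ : N × ℝ → G := fun p => if hp : p.2 ∈ J then τ p.1 p.2 hp p else 𝓖.unit (f p.1)
  have hρ : ∀ x t (ht : t ∈ J), ρ (x, t) = τ x t ht (x, t) := fun x t ht => dif_pos ht
  refine ⟨ρ, of_locally fun x _ t ht => ⟨U x t ht, K x t ht ∩ J, τ x t ht, hU x t ht, hxU x t ht,
    (hK x t ht).inter hJ, ⟨htK x t ht, ht⟩, (hτ x t ht).mono subset_rfl inter_subset_left, ?_⟩,
    fun x => ?_⟩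
  · rintro ⟨y, s⟩ ⟨hy, hsK, hs⟩
    rw [hρ y s hs]
    exact (hτ y s hs).eqOn (hτ x t ht) (hK y s hs) (hK x t ht) (hKc y s hs) (hKc x t ht)
      (hxU y s hs) hy (h0K y s hs) (h0K x t ht)
      ((hτ0 y s hs y (hxU y s hs)).trans (hτ0 x t ht y hy).symm) (htK y s hs) hsK
  · rw [hρ x 0 h0]
    exact hτ0 x 0 h0 x (hxU x 0 h0)

end IsLogSolution

end Gluing

/-! ### Smoothly exact deformations are trivial. -/

section Backward

open Set Filter Topology

variable {EH EN H N EG EM G M : Type*}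
  [NormedAddCommGroup EH] [NormedSpace ℝ EH] [NormedAddCommGroup EN] [NormedSpace ℝ EN]
  [NormedAddCommGroup EG] [NormedSpace ℝ EG] [NormedAddCommGroup EM] [NormedSpace ℝ EM]
  [TopologicalSpace H] [ChartedSpace EH H] [TopologicalSpace N] [ChartedSpace EN N]
  [TopologicalSpace G] [ChartedSpace EG G] [TopologicalSpace M] [ChartedSpace EM M]
  {𝓗 : LieGroupoid EH EN H N} {𝓖 : LieGroupoid EG EM G M}
  {Φ₀ : LieGroupoidHom 𝓗 𝓖} {I : Set ℝ}

namespace LieGroupoid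

variable [IsManifold 𝓘(ℝ, EG) ∞ G] [IsManifold 𝓘(ℝ, EM) ∞ M]

/-- If the curve of units over `β` has the velocity of the infinitesimal conjugation by `v`, then
`β` has the velocity of the anchor of `v`. -/
theorem exists_hasVelocity_anchor {β : ℝ → M} {v : EG} {e : ℝ} (hv : v ∈ 𝓖.algebroidFiber (β e))
    (hβ : HasVelocity 𝓘(ℝ, EG) (fun t => 𝓖.unit (β t))
      (𝓖.infinitesimalAction (β e) (β e) (𝓖.unit (β e)) v v) e)
    {γ : ℝ → G} (hγ0 : γ e = 𝓖.unit (β e)) (hγ : HasVelocity 𝓘(ℝ, EG) γ v e) :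
    ∃ w : EM, HasVelocity 𝓘(ℝ, EM) (fun t => 𝓖.target (γ t)) w e ∧
      HasVelocity 𝓘(ℝ, EM) β w e := by
  obtain ⟨c, hc0, hcs, hc⟩ := 𝓖.exists_hasVelocity_source_eq hv e
  obtain ⟨L, hL⟩ := exists_hasMFDerivAt
    (𝓖.contMDiff_target.mdifferentiableAt (x := 𝓖.unit (β e)) (by simp))
  have hq := hasVelocity_mul_mul_inv hc hc hc0 hc0 (Eventually.of_forall hcs)
    (Eventually.of_forall hcs) (𝓖.target_unit _) (𝓖.source_unit _)
  -- Conjugating a unit by `c` gives the unit over the target of `c`, so the target map sends the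
  -- infinitesimal conjugation by `v` to the anchor of `v`.
  have hqu : ∀ t, 𝓖.mul (𝓖.mul (c t) (𝓖.unit (β e))) (𝓖.inv (c t)) =
      𝓖.unit (𝓖.target (c t)) := fun t => by
    rw [𝓖.mul_unit' (hcs t), 𝓖.mul_inv]
  have h1 := HasVelocity.comp hL hq (by rw [hqu, hc0, 𝓖.target_unit])
  have h2 : HasVelocity 𝓘(ℝ, EM) (fun t => 𝓖.target (c t)) _ e :=
    h1.congr (Eventually.of_forall fun t => by
      change 𝓖.target (c t) = 𝓖.target (𝓖.mul (𝓖.mul (c t) (𝓖.unit (β e))) (𝓖.inv (c t)))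
      rw [hqu, 𝓖.target_unit])
  have h3 := HasVelocity.comp hL hβ rfl
  simp only [𝓖.target_unit] at h3
  have h4 := HasVelocity.comp hL hc hc0
  have h5 := HasVelocity.comp hL hγ hγ0
  rw [h4.unique h2] at h5
  exact ⟨_, h5, h3⟩

end LieGroupoid

namespace MorphismDeformation

theorem hasVelocity_cocycle (Φ : MorphismDeformation 𝓗 𝓖 Φ₀ I) (hI : IsOpen I) {ε : ℝ}
    (hε : ε ∈ I) (h : H) :
    HasVelocity 𝓘(ℝ, EG) (fun e => Φ.toFun (h, e)) (Φ.cocycle ε h) ε := by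
  refine HasVelocity.of_mdifferentiableAt (γ := fun e => Φ.toFun (h, e)) ?_
  have h1 : ContMDiffOn 𝓘(ℝ, ℝ) 𝓘(ℝ, EG) ∞ (fun e => Φ.toFun (h, e)) I :=
    Φ.contMDiffOn.comp (contMDiff_const.prodMk contMDiff_id).contMDiffOn fun e he => ⟨trivial, he⟩
  exact (h1.contMDiffAt (hI.mem_nhds hε)).mdifferentiableAt (by simp)

theorem IsSmoothlyExactOn.isTrivialOn [FiniteDimensional ℝ EN] [FiniteDimensional ℝ EG]
    [IsManifold 𝓘(ℝ, EG) ∞ G] [IsManifold 𝓘(ℝ, EN) ∞ N] [IsManifold 𝓘(ℝ, EM) ∞ M] {Φ : MorphismDeformation 𝓗 𝓖 Φ₀ I}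
    {J : Set ℝ} (hI : IsOpen I) (hJ : IsOpenIntervalAroundZero J) (hJI : J ⊆ I)
    (h : Φ.IsSmoothlyExactOn J) : Φ.IsTrivialOn J := by
  obtain ⟨hJo, hJc, h0⟩ := hJ
  obtain ⟨α, ⟨hαmem, hα⟩, hex⟩ := h
  let a : N × ℝ → EG := α
  have hvel : ∀ ε ∈ J, ∀ h, HasVelocity 𝓘(ℝ, EG) (fun e => Φ.toFun (h, e))
      (𝓖.infinitesimalAction (Φ.base (𝓗.target h, ε)) (Φ.base (𝓗.source h, ε)) (Φ.toFun (h, ε))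
        (a (𝓗.target h, ε)) (a (𝓗.source h, ε))) ε := by
    intro ε hε h
    have h1 := Φ.hasVelocity_cocycle hI (hJI hε) h
    rw [hex ε hε h] at h1
    exact h1
  have hanchor : ∀ x, ∀ t ∈ J, ∀ γ : ℝ → G, γ t = 𝓖.unit (Φ.base (x, t)) →
      HasVelocity 𝓘(ℝ, EG) γ (a (x, t)) t → ∃ v : EM,
        HasVelocity 𝓘(ℝ, EM) (fun s => 𝓖.target (γ s)) v t ∧
        HasVelocity 𝓘(ℝ, EM) (fun s => Φ.base (x, s)) v t := by
    intro x t ht γ hγ0 hγ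
    refine LieGroupoid.exists_hasVelocity_anchor (β := fun s => Φ.base (x, s)) (v := a (x, t))
      (hαmem x t ht) ?_ hγ0 hγ
    -- On unit arrows the exactness equation describes the velocity of the units over `φ_t(x)`,
    -- which determines the anchor of `α`.
    have h1 := hvel t ht (𝓗.unit x)
    rw [𝓗.target_unit, 𝓗.source_unit, (Φ.isHom t (hJI ht)).map_unit x] at h1
    refine h1.congr ?_
    filter_upwards [hJo.mem_nhds ht] with s hs using ((Φ.isHom s (hJI hs)).map_unit x).symm
  obtain ⟨τ, hτ, hτ0⟩ := IsLogSolution.exists_global (𝓖 := 𝓖) (EN := EN) (φ := Φ.base) (α := a)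
    (f := fun x => Φ.base (x, 0)) (fun x t ht => IsLogSolution.exists_of_forall_local hJc h0
      (fun t₀ ht₀ => exists_isLogSolution hJo
        (Φ.contMDiffOn_base.mono (prod_mono subset_rfl hJI)) hαmem hα hanchor x ht₀) ht) h0 hJo
  simp only [Φ.base_zero] at hτ0
  have hτs : ∀ x, ∀ ε ∈ J, 𝓖.source (τ (x, ε)) = Φ₀.base x := fun x ε hε =>
    (hτ.source_eq x trivial ε hε).trans (Φ.base_zero x)
  refine ⟨τ, ⟨hτ.contMDiffOn, hτs⟩, hτ0, fun ε hε h => ?_⟩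
  change Φ.toFun (h, ε) = 𝓖.mul (𝓖.mul (τ (𝓗.target h, ε)) (Φ₀.toFun h))
    (𝓖.inv (τ (𝓗.source h, ε)))
  have hΦt : ∀ t ∈ J, 𝓖.target (Φ.toFun (h, t)) = 𝓖.target (τ (𝓗.target h, t)) := fun t ht =>
    ((Φ.isHom t (hJI ht)).target_map h).trans (hτ.target_eq _ trivial t ht).symm
  have hΦs : ∀ t ∈ J, 𝓖.source (Φ.toFun (h, t)) = 𝓖.target (τ (𝓗.source h, t)) := fun t ht =>
    ((Φ.isHom t (hJI ht)).source_map h).trans (hτ.target_eq _ trivial t ht).symm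
  -- The product `τ_t(t(h))⁻¹ Φ_t(h) τ_t(s(h))` is constant in `t`. Comparing the times `ε` and `0`
  -- gives `Φ₀(h)`, and solving for `Φ_ε(h)` finishes the proof.
  have h1 := 𝓖.eq_of_hasLogVelocity (τ := fun t => τ (𝓗.target h, t))
    (σ := fun t => τ (𝓗.source h, t)) (γ := fun t => Φ.toFun (h, t)) hJo hJc.isPreconnected
    (hτs _) (hτs _) (hτ.log _ trivial) (hτ.log _ trivial) hΦt hΦs (fun t ht => by
      rw [hτ.target_eq _ trivial t ht, hτ.target_eq _ trivial t ht]
      exact hvel t ht h) hε h0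
  simp only [hτ0, Φ.toFun_zero, 𝓖.inv_unit] at h1
  rw [𝓖.unit_mul' (Φ₀.isHom.target_map h), 𝓖.mul_unit' (Φ₀.isHom.source_map h)] at h1
  have hc1 : 𝓖.source (𝓖.inv (τ (𝓗.target h, ε))) = 𝓖.target (Φ.toFun (h, ε)) := by
    rw [𝓖.source_inv, hΦt ε hε]
  have hc2 : 𝓖.source (𝓖.mul (𝓖.inv (τ (𝓗.target h, ε))) (Φ.toFun (h, ε))) =
      𝓖.target (τ (𝓗.source h, ε)) := by
    rw [𝓖.source_mul _ _ hc1, hΦs ε hε]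
  rw [← h1, 𝓖.mul_assoc _ _ _ hc1 (hΦs ε hε), 𝓖.mul_inv_cancel_left,
    𝓖.mul_inv_cancel_right (hΦs ε hε)]
  rw [𝓖.target_mul _ _ (hΦs ε hε), hΦt ε hε]

end MorphismDeformation

end Backward

theorem mainTheorem2
    {EH EN EG EM : Type*}
    [NormedAddCommGroup EH] [NormedSpace ℝ EH] [FiniteDimensional ℝ EH]
    [NormedAddCommGroup EN] [NormedSpace ℝ EN] [FiniteDimensional ℝ EN]
    [NormedAddCommGroup EG] [NormedSpace ℝ EG] [FiniteDimensional ℝ EG]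
    [NormedAddCommGroup EM] [NormedSpace ℝ EM] [FiniteDimensional ℝ EM]
    {H N G M : Type*}
    [TopologicalSpace H] [ChartedSpace EH H] [IsManifold 𝓘(ℝ, EH) ∞ H]
    [TopologicalSpace N] [ChartedSpace EN N] [IsManifold 𝓘(ℝ, EN) ∞ N] [T2Space N]
    [TopologicalSpace G] [ChartedSpace EG G] [IsManifold 𝓘(ℝ, EG) ∞ G]
    [TopologicalSpace M] [ChartedSpace EM M] [IsManifold 𝓘(ℝ, EM) ∞ M] [T2Space M]
    (𝓗 : LieGroupoid EH EN H N) (𝓖 : LieGroupoid EG EM G M) (Φ₀ : LieGroupoidHom 𝓗 𝓖)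
    (I : Set ℝ) (hI : IsOpenIntervalAroundZero I)
    (Φ : MorphismDeformation 𝓗 𝓖 Φ₀ I) :
    (∀ J : Set ℝ, IsOpenIntervalAroundZero J → J ⊆ I →
      (Φ.IsTrivialOn J ↔ Φ.IsSmoothlyExactOn J)) ∧
    (Φ.IsTrivial ↔ Φ.IsSmoothlyExact) := by
  have h : ∀ J : Set ℝ, IsOpenIntervalAroundZero J → J ⊆ I →
      (Φ.IsTrivialOn J ↔ Φ.IsSmoothlyExactOn J) := fun J hJ hJI =>
    ⟨fun hΦ => hΦ.isSmoothlyExactOn hJ.1 hJI, fun hΦ => hΦ.isTrivialOn hI.1 hJ hJI⟩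
  exact ⟨h, exists_congr fun J => and_congr_right fun hJ => and_congr_right fun hJI => h J hJ hJI⟩
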